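/- Let $G(n,q)$ be the binomial random graph on $n$ labelled vertices (each edge present independently with probability $q$). Let $\mathcal G(n,m,p)$ be the random intersection graph: there are $n$ vertices and $m$ objects, every vertex $v$ receives a random set $W(v)$ of objects that contains each object with probability $p$, independently for all vertices and objects, and two distinct vertices $v,v'$ are adjacent if and only if $W(v)\cap W(v')\neq\emptyset$. A monotone graph property $\mathcal A$ is, for each $n$, a set of graphs on $n$ labelled vertices that is closed under isomorphism and is either (for all $n$) closed under adding edges or (for all $n$) closed under deleting edges. All limits and the symbols $O,\Omega,o$ refer to $n\to\infty$. Let $a\in[0,1]$, let $\alpha\ge 3$ be a real constant, let $m=m(n)=n^{\alpha}$ (rounded, up or down, to an integer), and let $\mathcal A$ be a monotone graph property. (i) Let $p=p(n)\in[0,1]$ satisfy $$\Omega\left(\frac{1}{n\sqrt[3]{m}}\right)=p=O\left(\sqrt{\frac{\ln n}{m}}\right),$$ and, in the case $\alpha=3$, also $\frac{1}{n\sqrt[3]{m}}=o(p)$. Put $q_2=1-\exp\left(-mp^2(1-p)^{n-2}\right)$. If $$\Pr\{G(n,q_2)\in\mathcal A\}\to a$$ and for every sequence $\varepsilon=\varepsilon(n)\to0$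 of real numbers with $(1+\varepsilon)q_2\in[0,1]$ for all large $n$ $$\Pr\{G(n,(1+\varepsilon)q_2)\in\mathcal A\}\to a,$$ then $$\Pr\{\mathcal G(n,m,p)\in\mathcal A\}\to a.$$ (ii) Let $\hat p=\hat p(n)\in[0,1)$ be a sequence bounded away from one by a constant; in the case $\alpha=3$ assume in addition that $n\hat p$ has no limit point in $(0,\infty)$, that is, for all $0<c<C$ we have $n\hat p\notin[c,C]$ for all large $n$ (this holds in particular if $\hat p=o(1/n)$ or $1/n=o(\hat p)$). If for every sequence $\varepsilon=\varepsilon(n)\to0$ of real numbers $$\Pr\left\{\mathcal G\left(n,m,\sqrt{-\frac{\ln\left(1-\frac{\hat p}{1+\varepsilon}\right)}{m}}\right)\in\mathcal A\right\}\to a \quad\text{and}\quad \Pr\left\{\mathcal G\left(n,m,\sqrt{-\frac{\ln(1-\hat p)}{(1-\varepsilon)m}}\right)\in\mathcal A\right\}\to a,$$ then $$\Pr\{G(n,\hat p)\in\mathcal A\}\to a.$$ -/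

import Mathlib

open MeasureTheory ProbabilityTheory Filter Topology Asymptotics

noncomputable section

/-- A real number read as a probability; the identity on `[0, 1]`. Values outside `[0, 1]`, which
in the theorem can only occur for finitely many indices, are moved to the nearest end point. -/
def asProb (x : ℝ) : unitInterval := Set.projIcc (0 : ℝ) 1 zero_le_one x

/-- The graph on `V` in which two distinct vertices are adjacent when they share an object of `W`;
`(v, w) ∈ R` means that the object `w` belongs to the set assigned to the vertex `v`. -/
def intersectionGraph {V W : Type*} (R : Set (V × W)) : SimpleGraph V where
  Adj v₁ v₂ := v₁ ≠ v₂ ∧ ∃ w, (v₁, w) ∈ R ∧ (v₂, w) ∈ R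
  symm := ⟨fun _ _ h => ⟨h.1.symm, h.2.imp fun _ hw => hw.symm⟩⟩
  loopless := ⟨fun _ h => h.1 rfl⟩

/-- The law of the random intersection graph `G(n, m, p)`: each of the `m` objects is put into the
set of each of the `n` vertices with probability `p`, independently. -/
def randomIntersectionGraph (n m : ℕ) (p : unitInterval) : Measure (SimpleGraph (Fin n)) :=
  (setBernoulli (Set.univ : Set (Fin n × Fin m)) p).map intersectionGraph

/-- The map to graphs is measurable, so the push-forward above is a genuine law. -/
theorem measurable_intersectionGraph (n m : ℕ) :
    Measurable (intersectionGraph : Set (Fin n × Fin m) → SimpleGraph (Fin n)) := by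
  exact measurable_of_countable _

instance (n m : ℕ) (p : unitInterval) : IsProbabilityMeasure (randomIntersectionGraph n m p) :=
  Measure.isProbabilityMeasure_map (measurable_intersectionGraph n m).aemeasurable

/-- The probability that the binomial random graph `G(n, q)` belongs to `A`. -/
def probGnp (n : ℕ) (q : ℝ) (A : Set (SimpleGraph (Fin n))) : ℝ :=
  (SimpleGraph.binomialRandom (Fin n) (asProb q)).real A

/-- The probability that the random intersection graph `G(n, m, p)` belongs to `A`. -/
def probGnmp (n m : ℕ) (p : ℝ) (A : Set (SimpleGraph (Fin n))) : ℝ :=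
  (randomIntersectionGraph n m (asProb p)).real A

/-- A set of graphs on `V` that is closed under isomorphism. -/
def IsGraphProperty {V : Type*} (A : Set (SimpleGraph V)) : Prop :=
  ∀ G G' : SimpleGraph V, Nonempty (G ≃g G') → G ∈ A → G' ∈ A

/-- An increasing property: closed under isomorphism and under adding edges. -/
def IsIncreasing {V : Type*} (A : Set (SimpleGraph V)) : Prop :=
  IsGraphProperty A ∧ ∀ G G' : SimpleGraph V, G ≤ G' → G ∈ A → G' ∈ A

/-- A decreasing property: closed under isomorphism and under deleting edges. -/
def IsDecreasing {V : Type*} (A : Set (SimpleGraph V)) : Prop :=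
  IsGraphProperty A ∧ ∀ G G' : SimpleGraph V, G' ≤ G → G ∈ A → G' ∈ A

/-- A monotone graph property, given by its set `A n` of graphs on `n` vertices for each `n`. -/
def IsMonotoneProperty (A : ∀ n : ℕ, Set (SimpleGraph (Fin n))) : Prop :=
  (∀ n, IsIncreasing (A n)) ∨ (∀ n, IsDecreasing (A n))

/-- The number `1 - exp(-m p² (1 - p) ^ (n - 2))` (only `n ≥ 2` matters). -/
def edgeProb (n m : ℕ) (p : ℝ) : ℝ :=
  1 - Real.exp (-((m : ℝ) * p ^ 2 * (1 - p) ^ (n - 2)))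

end

/-!
For an increasing property it suffices to compare the two models at slightly different densities
with a vanishing error; a decreasing property is treated through its complement. The comparisons
hold for every fixed `ε > 0`, and `exists_seq_tendsto_zero` turns them into comparisons along some
`ε n → 0`, to which the hypotheses apply.

The union of a family of independent random edge sets is described by operators: a random set `h`
acts on functions of edge sets by `f ↦ 𝔼 f (· ∪ h)`, independent unions are compositions, and all
these operators commute. The intersection graph is `objectStep ^ m` (`probGnmp_eq_objectStep`), one
factor for each object, which adds the clique on the vertices that hold the object. The binomial
graph is `noise q` (`probGnp_eq_noise`). A Poisson number of steps that each add at most one edge is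
again a binomial graph (`hasSum_poisson_singleStep`), and a Chernoff bound exchanges the Poisson
number for `m`.

*Lower comparison.* Objects held by exactly two vertices add single edges, so `objectStep` dominates
a single-edge step of intensity `p ^ 2 * (1 - p) ^ (n - 2)` (`probGnp_le_probGnmp`).

*Upper comparison.* Adding independent noise of intensity about `θ * m * p ^ 2` only helps an
increasing property. In its presence one object after the other is replaced by a single-edge step of
intensity `(1 + θ) * p ^ 2`, as in Lindeberg's proof of the central limit theorem
(`IsRandomUnion.replace`). If the clique of an object matters, then one of its edges is pivotal
after some of the others have been added; by the finite energy of the noise this has at most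
`r ^ (-k)` times the probability that the noise itself contains these `k` other edges while the edge
is pivotal (`noise_addSet_sub_le`). Only edges that are present have to be paid for, so summed over
all cliques through a given edge the price is governed by the degrees and codegrees of the graph
(`noise_objectStep_le`), and these are small outside an event of negligible probability
(`noise_hasLargeDegree_le`). That event is added to the property, where nothing is pivotal on it
(`probGnmp_le_of_bad`).

The numerical conditions amount to: triangles coming from a single object are absent
(`m * (n * p) ^ 3` small) or much rarer than those of the binomial graph (`m ^ 2 * p ^ 3` large).
Cliques on four to six vertices are either absent or hidden by the same estimate, and cliques on
seven or more are always absent (`eventually_probGnmp_le`). The lower bound on `p`, respectively the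
gap condition on `n * q` when `α = 3`, provides this dichotomy for triangles.
-/

noncomputable section

/-! ### Random unions as operators -/

section Operators

variable {E : Type*} [DecidableEq E]

/-- The operator `f ↦ f (· ∪ h)` on functions of a finite set. If `T` averages `addSet h` over a
random set `h`, then `T f g` is the expectation of `f (g ∪ h)`, and composing such operators
corresponds to taking unions of independent random sets. -/
def addSet (h : Finset E) : Module.End ℝ (Finset E → ℝ) :=
  LinearMap.funLeft ℝ ℝ (· ∪ h)

@[simp] theorem addSet_apply (h : Finset E) (f : Finset E → ℝ) (g : Finset E) :
    addSet h f g = f (g ∪ h) := rfl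

theorem addSet_mul (h k : Finset E) : addSet h * addSet k = addSet (h ∪ k) := by
  ext f g; simp [Module.End.mul_apply, Finset.union_assoc]

theorem commute_addSet (h k : Finset E) : Commute (addSet h) (addSet k) := by
  rw [Commute, SemiconjBy, addSet_mul, addSet_mul, Finset.union_comm]

/-- The properties of an operator of the form `f ↦ 𝔼 f (· ∪ h)`, where `h` is a random set. -/
structure IsRandomUnion (T : Module.End ℝ (Finset E → ℝ)) : Prop where
  nonneg : ∀ f, 0 ≤ f → 0 ≤ T f
  map_one : T 1 = 1
  comm : ∀ h, Commute T (addSet h)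
  le_apply : ∀ f : Finset E → ℝ, Monotone f → f ≤ T f

theorem isRandomUnion_sum {ι : Type*} (s : Finset ι) (c : ι → ℝ) (h : ι → Finset E)
    (hc : ∀ i ∈ s, 0 ≤ c i) (h1 : ∑ i ∈ s, c i = 1) :
    IsRandomUnion (∑ i ∈ s, c i • addSet (h i)) where
  nonneg f hf g := by
    simp only [LinearMap.sum_apply, LinearMap.smul_apply, Finset.sum_apply, Pi.smul_apply,
      addSet_apply, smul_eq_mul, Pi.zero_apply]
    exact Finset.sum_nonneg fun i hi => mul_nonneg (hc i hi) (hf _)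
  map_one := by
    ext g
    simp [LinearMap.sum_apply, h1]
  comm k := Commute.sum_left _ _ _ fun i _ => (commute_addSet _ _).smul_left _
  le_apply f hf g := by
    simp only [LinearMap.sum_apply, LinearMap.smul_apply, Finset.sum_apply, Pi.smul_apply,
      addSet_apply, smul_eq_mul]
    calc f g = ∑ i ∈ s, c i * f g := by rw [← Finset.sum_mul, h1, one_mul]
      _ ≤ _ := Finset.sum_le_sum fun i hi =>
        mul_le_mul_of_nonneg_left (hf Finset.subset_union_left) (hc i hi)

namespace IsRandomUnion

variable {T T' : Module.End ℝ (Finset E → ℝ)}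

theorem mono (hT : IsRandomUnion T) {f f' : Finset E → ℝ} (h : f ≤ f') : T f ≤ T f' := by
  have := hT.nonneg (f' - f) (sub_nonneg.2 h)
  rwa [map_sub, sub_nonneg] at this

theorem map_const (hT : IsRandomUnion T) (c : ℝ) : T (fun _ => c) = fun _ => c := by
  have : (fun _ => c : Finset E → ℝ) = c • 1 := by ext; simp
  rw [this, map_smul, hT.map_one]

theorem mono_add_const (hT : IsRandomUnion T) {f f' : Finset E → ℝ} {c : ℝ}
    (h : ∀ g, f g ≤ f' g + c) (g : Finset E) : T f g ≤ T f' g + c := by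
  have := hT.mono (f := f) (f' := f' + fun _ => c) h g
  rwa [map_add, hT.map_const] at this

theorem monotone (hT : IsRandomUnion T) {f : Finset E → ℝ} (hf : Monotone f) :
    Monotone (T f) := by
  intro g k hgk
  have h1 : f ≤ addSet k f := fun x => hf Finset.subset_union_left
  have h2 := hT.mono h1 g
  have h3 : T (addSet k f) = addSet k (T f) := LinearMap.congr_fun (hT.comm k) f
  rw [h3, addSet_apply, Finset.union_eq_right.2 hgk] at h2
  exact h2

theorem one : IsRandomUnion (1 : Module.End ℝ (Finset E → ℝ)) where
  nonneg _ hf := hf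
  map_one := rfl
  comm _ := Commute.one_left _
  le_apply _ _ := le_rfl

theorem mul (hT : IsRandomUnion T) (hT' : IsRandomUnion T') : IsRandomUnion (T * T') where
  nonneg f hf := hT.nonneg _ (hT'.nonneg f hf)
  map_one := by rw [Module.End.mul_apply, hT'.map_one, hT.map_one]
  comm h := (hT.comm h).mul_left (hT'.comm h)
  le_apply f hf := (hT'.le_apply f hf).trans (hT.le_apply _ (hT'.monotone hf))

theorem pow (hT : IsRandomUnion T) (k : ℕ) : IsRandomUnion (T ^ k) := by
  induction k with
  | zero => simpa using one
  | succ k ih => rw [pow_succ]; exact ih.mul hT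

theorem nonneg_apply (hT : IsRandomUnion T) {f : Finset E → ℝ} (hf : ∀ g, 0 ≤ f g)
    (g : Finset E) : 0 ≤ T f g := hT.nonneg f hf g

theorem apply_le_one (hT : IsRandomUnion T) {f : Finset E → ℝ} (hf : ∀ g, f g ≤ 1)
    (g : Finset E) : T f g ≤ 1 := by
  have := hT.mono (f := f) (f' := 1) hf g
  rwa [hT.map_one] at this

/-- Lindeberg's replacement: if one application of `T` can be replaced by `T'` at cost `τ` in the
presence of `N`, then `m` applications can be replaced at cost `m * τ`. -/
theorem replace (hT : IsRandomUnion T) (hT' : IsRandomUnion T') {N : Module.End ℝ (Finset E → ℝ)}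
    (hTT' : Commute T T') (hTN : Commute T N) (hTN' : Commute T' N)
    (f : Finset E → ℝ) (τ : ℝ) (h : ∀ g, N (T f) g ≤ N (T' f) g + τ) (m : ℕ) (g : Finset E) :
    (T ^ m) (N f) g ≤ (T' ^ m) (N f) g + m * τ := by
  induction m generalizing g with
  | zero => simp
  | succ m ih =>
    have e1 : (T ^ (m + 1)) (N f) = (T ^ m) (N (T f)) := by
      rw [pow_succ, Module.End.mul_apply]
      exact congrArg _ (LinearMap.congr_fun hTN f)
    have e2 : (T ^ m) (N (T' f)) = T' ((T ^ m) (N f)) := by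
      have h1 : N (T' f) = T' (N f) := (LinearMap.congr_fun hTN' f).symm
      rw [h1]
      exact LinearMap.congr_fun (hTT'.pow_left m) (N f)
    have h3 := (hT.pow m).mono_add_const h g
    have h4 := hT'.mono_add_const ih g
    rw [← e1, e2] at h3
    have h5 : T' ((T' ^ m) (N f)) = (T' ^ (m + 1)) (N f) := by
      rw [pow_succ', Module.End.mul_apply]
    rw [h5] at h4
    push_cast
    linarith

theorem pow_le_pow (hT : IsRandomUnion T) (hT' : IsRandomUnion T') {f : Finset E → ℝ}
    (hf : Monotone f) (h : ∀ f, Monotone f → T f ≤ T' f) (m : ℕ) : (T ^ m) f ≤ (T' ^ m) f := by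
  induction m with
  | zero => simp
  | succ m ih =>
    rw [pow_succ', pow_succ', Module.End.mul_apply, Module.End.mul_apply]
    exact (h _ ((hT.pow m).monotone hf)).trans (hT'.mono ih)

theorem pow_apply_mono (hT : IsRandomUnion T) {f : Finset E → ℝ} (hf : Monotone f)
    (g : Finset E) : Monotone fun k : ℕ => (T ^ k) f g := by
  refine monotone_nat_of_le_succ fun k => ?_
  rw [pow_succ', Module.End.mul_apply]
  exact hT.le_apply _ ((hT.pow k).monotone hf) g

end IsRandomUnion

/-! ### Adding independent elements -/

/-- One step of the process that adds each single element of `P` with probability `s`, and nothing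
otherwise. -/
def singleStep (s : ℝ) (P : Finset E) : Module.End ℝ (Finset E → ℝ) :=
  1 + s • ∑ e ∈ P, (addSet {e} - 1)

/-- Union with a random subset of `P` that contains each element with probability `r`,
independently. -/
def noise (r : ℝ) (P : Finset E) : Module.End ℝ (Finset E → ℝ) :=
  ∑ F ∈ P.powerset, (r ^ F.card * (1 - r) ^ (P \ F).card) • addSet F

theorem singleStep_apply (s : ℝ) (P : Finset E) (f : Finset E → ℝ) (g : Finset E) :
    singleStep s P f g = f g + s * ∑ e ∈ P, (f (g ∪ {e}) - f g) := by
  simp [singleStep, LinearMap.sum_apply]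

theorem noise_apply (r : ℝ) (P : Finset E) (f : Finset E → ℝ) (g : Finset E) :
    noise r P f g = ∑ F ∈ P.powerset, r ^ F.card * (1 - r) ^ (P \ F).card * f (g ∪ F) := by
  simp [noise, LinearMap.sum_apply]

theorem isRandomUnion_singleStep {s : ℝ} {P : Finset E} (hs : 0 ≤ s) (hP : s * P.card ≤ 1) :
    IsRandomUnion (singleStep s P) where
  nonneg f hf g := by
    rw [singleStep_apply, Finset.sum_sub_distrib, Finset.sum_const, nsmul_eq_mul]
    have h1 : 0 ≤ ∑ e ∈ P, f (g ∪ {e}) := Finset.sum_nonneg fun e _ => hf _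
    have h2 : 0 ≤ f g := hf g
    have h3 := mul_nonneg hs h1
    have h4 := mul_nonneg (sub_nonneg.2 hP) h2
    show (0 : ℝ) ≤ _
    linarith
  map_one := by
    ext g; simp [singleStep_apply]
  comm h := by
    refine (Commute.one_left _).add_left (Commute.smul_left ?_ _)
    exact Commute.sum_left _ _ _ fun e _ => (commute_addSet _ _).sub_left (Commute.one_left _)
  le_apply f hf g := by
    rw [singleStep_apply]
    have : 0 ≤ ∑ e ∈ P, (f (g ∪ {e}) - f g) :=
      Finset.sum_nonneg fun e _ => sub_nonneg.2 (hf Finset.subset_union_left)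
    have := mul_nonneg hs this
    linarith

theorem sum_bernoulli_weight (r : ℝ) (P : Finset E) :
    ∑ F ∈ P.powerset, r ^ F.card * (1 - r) ^ (P \ F).card = 1 := by
  have := Finset.prod_add (fun _ : E => r) (fun _ => 1 - r) P
  simp only [Finset.prod_const] at this
  rw [← this]; simp

theorem isRandomUnion_noise {r : ℝ} (P : Finset E) (h0 : 0 ≤ r) (h1 : r ≤ 1) :
    IsRandomUnion (noise r P) :=
  isRandomUnion_sum _ _ _
    (fun _ _ => mul_nonneg (pow_nonneg h0 _) (pow_nonneg (sub_nonneg.2 h1) _))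
    (sum_bernoulli_weight r P)

theorem IsRandomUnion.commute_noise {T : Module.End ℝ (Finset E → ℝ)} (hT : IsRandomUnion T)
    (r : ℝ) (P : Finset E) : Commute T (noise r P) :=
  Commute.sum_right _ _ _ fun F _ => (hT.comm F).smul_right _

theorem IsRandomUnion.commute_singleStep {T : Module.End ℝ (Finset E → ℝ)} (hT : IsRandomUnion T)
    (s : ℝ) (P : Finset E) : Commute T (singleStep s P) := by
  refine (Commute.one_right _).add_right (Commute.smul_right ?_ _)
  exact Commute.sum_right _ _ _ fun e _ => (hT.comm _).sub_right (Commute.one_right _)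

theorem noise_insert (r : ℝ) {P : Finset E} {e : E} (he : e ∉ P) (f : Finset E → ℝ)
    (g : Finset E) :
    noise r (insert e P) f g = (1 - r) * noise r P f g + r * noise r P f (g ∪ {e}) := by
  simp only [noise_apply, Finset.mul_sum]
  rw [Finset.sum_powerset_insert he]
  congr 1
  · refine Finset.sum_congr rfl fun F hF => ?_
    have heF : e ∉ F := fun h => he (Finset.mem_powerset.1 hF h)
    rw [Finset.insert_sdiff_of_notMem _ heF, Finset.card_insert_of_notMem (by simp [he]), pow_succ]
    ring
  · refine Finset.sum_congr rfl fun F hF => ?_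
    have heF : e ∉ F := fun h => he (Finset.mem_powerset.1 hF h)
    have h1 : insert e P \ insert e F = P \ F := by
      ext x
      simp only [Finset.mem_sdiff, Finset.mem_insert]
      constructor
      · rintro ⟨h | h, h'⟩
        · exact absurd (Or.inl h) h'
        · exact ⟨h, fun h2 => h' (Or.inr h2)⟩
      · rintro ⟨h, h'⟩
        refine ⟨Or.inr h, ?_⟩
        rintro (rfl | h2)
        · exact he h
        · exact h' h2
    rw [h1, Finset.card_insert_of_notMem heF, pow_succ, Finset.union_assoc, Finset.singleton_union]
    ring

/-- Finite energy of the noise: adding `e` by force costs at most a factor `1 / r`, and the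
resulting set then contains `e`. -/
theorem noise_finite_energy {r : ℝ} (P : Finset E) (h0 : 0 ≤ r) (h1 : r ≤ 1) {e : E} (he : e ∈ P)
    {f : Finset E → ℝ} (hf : 0 ≤ f) (g : Finset E) :
    r * noise r P (addSet {e} f) g ≤ noise r P (fun x => if e ∈ x then f x else 0) g := by
  obtain ⟨Q, heQ, rfl⟩ : ∃ Q, e ∉ Q ∧ P = insert e Q :=
    ⟨P.erase e, by simp, (Finset.insert_erase he).symm⟩
  rw [noise_insert r heQ, noise_insert r heQ]
  have key : ∀ x, noise r Q (addSet {e} f) x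
      = noise r Q (fun x => if e ∈ x then f x else 0) (x ∪ {e}) := by
    intro x
    simp only [noise_apply, addSet_apply]
    refine Finset.sum_congr rfl fun F _ => ?_
    rw [if_pos (by simp), Finset.union_right_comm]
  have h3 : 0 ≤ noise r Q (fun x => if e ∈ x then f x else 0) g := by
    refine (isRandomUnion_noise Q h0 h1).nonneg_apply (fun x => ?_) g
    split_ifs
    · exact hf x
    · exact le_rfl
  rw [key, key, Finset.union_assoc, Finset.union_self]
  have := mul_nonneg (sub_nonneg.2 h1) h3
  linarith

/-- Finite energy for several elements: forcing `F` costs at most a factor `r ^ (-#F)`. -/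
theorem noise_finite_energy_finset {r : ℝ} (P : Finset E) (h0 : 0 < r) (h1 : r ≤ 1)
    {F : Finset E} (hF : F ⊆ P) {f : Finset E → ℝ} (hf : 0 ≤ f) (g : Finset E) :
    r ^ F.card * noise r P (addSet F f) g ≤ noise r P (fun x => if F ⊆ x then f x else 0) g := by
  induction F using Finset.induction_on generalizing f with
  | empty =>
    have : addSet ∅ f = f := by ext x; simp
    simp [this]
  | insert e F heF ih =>
    have heP : e ∈ P := hF (Finset.mem_insert_self _ _)
    have hFP : F ⊆ P := (Finset.subset_insert _ _).trans hF
    have e1 : addSet (insert e F) f = addSet {e} (addSet F f) := by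
      ext x; simp only [addSet_apply, Finset.union_assoc, Finset.singleton_union]
    have hf' : 0 ≤ addSet F f := fun x => hf (x ∪ F)
    have e2 := noise_finite_energy P h0.le h1 heP hf' g
    have e3 : noise r P (fun x => if e ∈ x then addSet F f x else 0) g
        ≤ noise r P (addSet F fun x => if e ∈ x then f x else 0) g := by
      refine (isRandomUnion_noise P h0.le h1).mono (fun x => ?_) g
      simp only [addSet_apply]
      by_cases hx : e ∈ x
      · simp [hx]
      · rw [if_neg hx]
        split_ifs
        · exact hf _
        · exact le_rfl
    have hf2 : (0 : Finset E → ℝ) ≤ fun x => if e ∈ x then f x else 0 := by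
      intro x
      show (0 : ℝ) ≤ if e ∈ x then f x else 0
      split_ifs
      · exact hf _
      · exact le_rfl
    have e4 := ih hFP hf2
    have e5 : (fun x => if F ⊆ x then (if e ∈ x then f x else 0) else 0)
        = fun x => if insert e F ⊆ x then f x else 0 := by
      ext x
      simp only [Finset.insert_subset_iff]
      split_ifs <;> tauto
    rw [e5] at e4
    rw [Finset.card_insert_of_notMem heF, e1, pow_succ, mul_assoc]
    refine (mul_le_mul_of_nonneg_left (e2.trans e3) (pow_nonneg h0.le _)).trans e4

/-- The factor `1 / r` that is paid for an element `a` forced into the random set; paid only if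
the random set ends up containing `a`. -/
def energyCost (r : ℝ) (g : Finset E) (a : E) : ℝ := if a ∈ g then r⁻¹ else 1

theorem one_le_energyCost {r : ℝ} (h0 : 0 < r) (h1 : r ≤ 1) (g : Finset E) (a : E) :
    1 ≤ energyCost r g a := by
  unfold energyCost
  split_ifs
  · exact (one_le_inv₀ h0).2 h1
  · exact le_rfl

/-- If adding a set `K` changes `f`, then some single element of `K` is pivotal after other elements
of `K` have been added; by finite energy this is charged to the event that the element is pivotal
for the noise itself. -/
theorem noise_addSet_sub_le {r : ℝ} (P : Finset E) (h0 : 0 < r) (h1 : r ≤ 1)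
    {K : Finset E} (hK : K ⊆ P) {f : Finset E → ℝ} (hf : Monotone f) (g : Finset E) :
    noise r P (addSet K f - f) g ≤ ∑ e ∈ K,
      noise r P (fun x => (f (x ∪ {e}) - f x) * ∏ a ∈ K.erase e, energyCost r x a) g := by
  have hN := isRandomUnion_noise P h0.le h1
  suffices H : ∀ L ⊆ K, noise r P (addSet L f - f) g ≤ ∑ e ∈ L,
      noise r P (fun x => (f (x ∪ {e}) - f x) * ∏ a ∈ K.erase e, energyCost r x a) g from
    H K subset_rfl
  intro L
  induction L using Finset.induction_on with
  | empty =>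
    intro _
    have : addSet ∅ f - f = 0 := by ext x; simp
    simp [this]
  | insert e L heL ih =>
    intro hL
    have hLK : L ⊆ K := (Finset.subset_insert _ _).trans hL
    have hLe : L ⊆ K.erase e := fun a ha =>
      Finset.mem_erase.2 ⟨fun h => heL (h ▸ ha), hLK ha⟩
    set D : Finset E → ℝ := fun x => f (x ∪ {e}) - f x with hD
    have hD0 : 0 ≤ D := fun x => sub_nonneg.2 (hf Finset.subset_union_left)
    have e1 : addSet (insert e L) f - f = addSet L D + (addSet L f - f) := by
      ext x
      simp only [Pi.sub_apply, Pi.add_apply, addSet_apply, hD, Finset.union_assoc]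
      rw [Finset.union_comm L {e}, Finset.singleton_union]
      ring
    rw [e1, map_add, Pi.add_apply, Finset.sum_insert heL]
    refine add_le_add ?_ (ih hLK)
    have e2 := noise_finite_energy_finset P h0 h1 (hLK.trans hK) hD0 g
    have e3 : noise r P (addSet L D) g
        ≤ noise r P ((r ^ L.card)⁻¹ • fun x => if L ⊆ x then D x else 0) g := by
      rw [map_smul, Pi.smul_apply, smul_eq_mul, le_inv_mul_iff₀ (pow_pos h0 _)]
      exact e2
    refine e3.trans (hN.mono (fun x => ?_) g)
    simp only [Pi.smul_apply, smul_eq_mul]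
    split_ifs with hx
    · rw [mul_comm]
      refine mul_le_mul_of_nonneg_left ?_ (hD0 x)
      calc (r ^ L.card)⁻¹ = ∏ a ∈ L, energyCost r x a := by
            rw [Finset.prod_congr rfl fun a ha => show energyCost r x a = r⁻¹ from if_pos (hx ha),
              Finset.prod_const, inv_pow]
        _ ≤ _ := Finset.prod_le_prod_of_subset_of_one_le hLe
            (fun a _ => zero_le_one.trans (one_le_energyCost h0 h1 x a))
            fun a _ _ => one_le_energyCost h0 h1 x a
    · rw [mul_zero]
      exact mul_nonneg (hD0 x) (Finset.prod_nonneg fun a _ =>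
        zero_le_one.trans (one_le_energyCost h0 h1 x a))

end Operators

/-! ### Poissonization -/

section Poissonization

theorem HasSum.congr_terms {a b : ℕ → ℝ} {x : ℝ} (h : HasSum a x) (hab : ∀ k, b k = a k) :
    HasSum b x := by
  rwa [funext hab]

variable {E : Type*} [DecidableEq E]

/-- The indicator of the event that the random set is contained in `S`. -/
def subsetIndicator (S g : Finset E) : ℝ := if g ⊆ S then 1 else 0

theorem addSet_subsetIndicator (h S : Finset E) :
    addSet h (subsetIndicator S) = subsetIndicator S h • subsetIndicator S := by
  ext g
  simp only [addSet_apply, subsetIndicator, Finset.union_subset_iff, Pi.smul_apply, smul_eq_mul]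
  split_ifs <;> simp_all

theorem singleStep_subsetIndicator (s : ℝ) (P S : Finset E) :
    singleStep s P (subsetIndicator S) = (1 - s * (P \ S).card) • subsetIndicator S := by
  ext g
  have h1 : ∀ e, subsetIndicator S (g ∪ {e}) - subsetIndicator S g
      = (if e ∈ S then 0 else -1) * subsetIndicator S g := by
    intro e
    have := congrFun (addSet_subsetIndicator {e} S) g
    rw [addSet_apply] at this
    rw [this]
    simp only [Pi.smul_apply, smul_eq_mul, subsetIndicator, Finset.singleton_subset_iff]
    split_ifs <;> simp
  rw [singleStep_apply, Finset.sum_congr rfl fun e _ => h1 e, ← Finset.sum_mul]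
  have h2 : ∑ e ∈ P, (if e ∈ S then (0 : ℝ) else -1) = -(P \ S).card := by
    rw [Finset.sum_ite, Finset.sdiff_eq_filter]
    simp
  rw [h2, Pi.smul_apply, smul_eq_mul]
  ring

theorem noise_subsetIndicator (r : ℝ) (P S : Finset E) :
    noise r P (subsetIndicator S) = (1 - r) ^ (P \ S).card • subsetIndicator S := by
  have h1 : noise r P (subsetIndicator S) = (∑ F ∈ P.powerset,
      (r ^ F.card * (1 - r) ^ (P \ F).card) * subsetIndicator S F) • subsetIndicator S := by
    simp only [noise, LinearMap.sum_apply, LinearMap.smul_apply, addSet_subsetIndicator,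
      Finset.sum_smul, smul_smul]
  rw [h1]
  congr 1
  have h2 := Finset.prod_add (fun a : E => if a ∈ S then r else 0) (fun _ => 1 - r) P
  have h3 : ∀ F : Finset E, ∏ a ∈ F, (if a ∈ S then r else 0)
      = r ^ F.card * subsetIndicator S F := by
    intro F
    by_cases hF : F ⊆ S
    · rw [Finset.prod_congr rfl fun a ha => if_pos (hF ha), Finset.prod_const,
        subsetIndicator, if_pos hF, mul_one]
    · obtain ⟨a, haF, haS⟩ := Finset.not_subset.1 hF
      rw [subsetIndicator, if_neg hF, mul_zero]
      exact Finset.prod_eq_zero haF (if_neg haS)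
  simp only [h3, Finset.prod_const] at h2
  calc _ = ∑ t ∈ P.powerset, r ^ t.card * subsetIndicator S t * (1 - r) ^ (P \ t).card :=
        Finset.sum_congr rfl fun F _ => by ring
    _ = _ := by
      rw [← h2, Finset.sdiff_eq_filter, Finset.card_filter, ← Finset.prod_pow_eq_pow_sum]
      refine Finset.prod_congr rfl fun a _ => ?_
      split_ifs with h
      · simp
      · simp

/-- The indicators of the events `g ⊆ S` span all functions, so a law of random sets is determined by
the probabilities of being contained in a given set. -/
theorem span_subsetIndicator [Fintype E] :
    Submodule.span ℝ (Set.range (subsetIndicator : Finset E → Finset E → ℝ)) = ⊤ := by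
  set M := Submodule.span ℝ (Set.range (subsetIndicator : Finset E → Finset E → ℝ)) with hM
  have h1 : ∀ F : Finset E, (Pi.single F 1 : Finset E → ℝ) ∈ M := by
    intro F
    induction F using Finset.strongInduction with
    | H F ih =>
      have : (Pi.single F 1 : Finset E → ℝ)
          = subsetIndicator F - ∑ F' ∈ F.ssubsets, Pi.single F' 1 := by
        ext g
        simp only [Pi.sub_apply, Finset.sum_apply, subsetIndicator, Pi.single_apply]
        rw [Finset.sum_ite_eq]
        simp only [Finset.mem_ssubsets]
        by_cases h : g = F
        · subst h; simp
        · by_cases h' : g ⊆ F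
          · simp [h, h', Finset.ssubset_iff_subset_ne]
          · simp [h, h', Finset.ssubset_iff_subset_ne]
      rw [this]
      refine M.sub_mem (Submodule.subset_span ⟨F, rfl⟩) (M.sum_mem fun F' hF' => ?_)
      exact ih F' (Finset.mem_ssubsets.1 hF')
  rw [eq_top_iff]
  intro f _
  have : f = ∑ F, f F • (Pi.single F 1 : Finset E → ℝ) := by
    ext g
    simp [Finset.sum_apply, Pi.single_apply]
  rw [this]
  exact M.sum_mem fun F _ => M.smul_mem _ (h1 F)

/-- A Poisson number of single steps produces independent elements. Both sides are linear in `f`,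
so it suffices to compare the probabilities that the random set is contained in a given `S`. -/
theorem hasSum_poisson_singleStep [Fintype E] (s μ r : ℝ) (P : Finset E) (f : Finset E → ℝ) :
    HasSum (fun k : ℕ => Real.exp (-μ) * (μ ^ k / k.factorial)
        * (singleStep s P ^ k) (noise r P f) ∅)
      (noise (1 - Real.exp (-(μ * s)) * (1 - r)) P f ∅) := by
  have hf : f ∈ Submodule.span ℝ (Set.range (subsetIndicator : Finset E → Finset E → ℝ)) := by
    rw [span_subsetIndicator]; trivial
  induction hf using Submodule.span_induction with
  | mem f hf =>
    obtain ⟨S, rfl⟩ := hf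
    have h1 : ∀ k : ℕ, (singleStep s P ^ k) (noise r P (subsetIndicator S)) ∅
        = (1 - r) ^ (P \ S).card * (1 - s * (P \ S).card) ^ k := by
      intro k
      rw [noise_subsetIndicator]
      have : (singleStep s P ^ k) (subsetIndicator S)
          = (1 - s * (P \ S).card) ^ k • subsetIndicator S := by
        induction k with
        | zero => simp
        | succ k ih =>
          rw [pow_succ', Module.End.mul_apply, ih, map_smul, singleStep_subsetIndicator,
            smul_smul, pow_succ]
      rw [map_smul, this]
      simp [subsetIndicator]
    simp only [h1]
    rw [noise_subsetIndicator]
    set c : ℕ := (P \ S).card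
    have h2 := (NormedSpace.expSeries_div_hasSum_exp (μ * (1 - s * c))).mul_left
      (Real.exp (-μ) * (1 - r) ^ c)
    rw [← Real.exp_eq_exp_ℝ] at h2
    have h3 : Real.exp (-μ) * (1 - r) ^ c * Real.exp (μ * (1 - s * c))
        = ((1 - (1 - Real.exp (-(μ * s)) * (1 - r))) ^ c • subsetIndicator S) ∅ := by
      have : Real.exp (-μ) * (1 - r) ^ c * Real.exp (μ * (1 - s * c))
          = Real.exp (-(μ * s)) ^ c * (1 - r) ^ c := by
        rw [← Real.exp_nat_mul, mul_right_comm, ← Real.exp_add]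
        congr 2
        ring
      rw [this, ← mul_pow, sub_sub_cancel]
      simp [subsetIndicator]
    rw [← h3]
    exact h2.congr_terms fun k => by rw [mul_pow]; ring
  | zero => simp
  | add f f' _ _ h h' =>
    simp only [map_add, Pi.add_apply, mul_add]
    exact h.add h'
  | smul a f _ h =>
    simp only [map_smul, Pi.smul_apply, smul_eq_mul]
    exact (h.mul_left a).congr_terms fun k => by ring

theorem hasSum_poisson (μ t : ℝ) :
    HasSum (fun k : ℕ => Real.exp (-μ) * (μ ^ k / k.factorial) * t ^ k)
      (Real.exp (μ * (t - 1))) := by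
  have h2 := (NormedSpace.expSeries_div_hasSum_exp (μ * t)).mul_left (Real.exp (-μ))
  rw [← Real.exp_eq_exp_ℝ, ← Real.exp_add] at h2
  rw [show μ * (t - 1) = -μ + μ * t by ring]
  exact h2.congr_terms fun k => by rw [mul_pow]; ring

/-- Replacing the fixed index `m` in a nondecreasing sequence by a Poisson variable of larger mean;
the error is the Chernoff bound for the event that the variable is below `m`. -/
theorem le_of_hasSum_poisson {a : ℕ → ℝ} (ha : Monotone a) (h0 : ∀ k, 0 ≤ a k) (h1 : ∀ k, a k ≤ 1)
    {μ t G : ℝ} (hμ : 0 ≤ μ) (ht0 : 0 < t) (ht1 : t ≤ 1) (m : ℕ)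
    (hG : HasSum (fun k : ℕ => Real.exp (-μ) * (μ ^ k / k.factorial) * a k) G) :
    a m ≤ G + (t ^ m)⁻¹ * Real.exp (μ * (t - 1)) := by
  have hs := hG.add ((hasSum_poisson μ t).mul_left (t ^ m)⁻¹)
  have h2 := (hasSum_poisson μ 1).mul_right (a m)
  simp only [one_pow, mul_one, sub_self, mul_zero, Real.exp_zero, one_mul] at h2
  refine hasSum_le (fun k => ?_) h2 hs
  have hw : 0 ≤ Real.exp (-μ) * (μ ^ k / k.factorial) := by positivity
  have : a m ≤ a k + (t ^ m)⁻¹ * t ^ k := by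
    rcases le_or_gt m k with h | h
    · have := ha h
      have : 0 ≤ (t ^ m)⁻¹ * t ^ k := by positivity
      linarith
    · have h3 : 1 ≤ (t ^ m)⁻¹ * t ^ k := by
        rw [inv_mul_eq_div, one_le_div (pow_pos ht0 _)]
        exact pow_le_pow_of_le_one ht0.le ht1 h.le
      linarith [h0 k, h1 m]
  calc _ ≤ Real.exp (-μ) * (μ ^ k / k.factorial) * (a k + (t ^ m)⁻¹ * t ^ k) :=
        mul_le_mul_of_nonneg_left this hw
    _ = _ := by ring

/-- Replacing a Poisson variable by a fixed index `m` above its mean in a nondecreasing sequence; the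
error is the Chernoff bound for the event that the variable exceeds `m`. -/
theorem hasSum_poisson_le {a : ℕ → ℝ} (ha : Monotone a) (h0 : ∀ k, 0 ≤ a k) (h1 : ∀ k, a k ≤ 1)
    {μ t G : ℝ} (hμ : 0 ≤ μ) (ht1 : 1 ≤ t) (m : ℕ)
    (hG : HasSum (fun k : ℕ => Real.exp (-μ) * (μ ^ k / k.factorial) * a k) G) :
    G ≤ a m + (t ^ m)⁻¹ * Real.exp (μ * (t - 1)) := by
  have ht0 : 0 < t := zero_lt_one.trans_le ht1
  have h2 := (hasSum_poisson μ 1).mul_right (a m)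
  simp only [one_pow, mul_one, sub_self, mul_zero, Real.exp_zero, one_mul] at h2
  have hs := h2.add ((hasSum_poisson μ t).mul_left (t ^ m)⁻¹)
  refine hasSum_le (fun k => ?_) hG hs
  have hw : 0 ≤ Real.exp (-μ) * (μ ^ k / k.factorial) := by positivity
  have : a k ≤ a m + (t ^ m)⁻¹ * t ^ k := by
    rcases le_or_gt k m with h | h
    · have := ha h
      have : 0 ≤ (t ^ m)⁻¹ * t ^ k := by positivity
      linarith
    · have h3 : 1 ≤ (t ^ m)⁻¹ * t ^ k := by
        rw [inv_mul_eq_div, one_le_div (pow_pos ht0 _)]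
        exact pow_le_pow_right₀ ht1 h.le
      linarith [h1 k, h0 m]
  calc _ ≤ Real.exp (-μ) * (μ ^ k / k.factorial) * (a m + (t ^ m)⁻¹ * t ^ k) :=
        mul_le_mul_of_nonneg_left this hw
    _ = _ := by ring

/-- The probability that the noise contains `F`. -/
theorem noise_superset {q : ℝ} {P F : Finset E} (hF : F ⊆ P) :
    noise q P (fun g => if F ⊆ g then 1 else 0) ∅ = q ^ F.card := by
  rw [noise_apply]
  have h2 := Finset.prod_add (fun _ : E => q) (fun a => if a ∈ F then 0 else 1 - q) P
  have h3 : ∀ F' ∈ P.powerset, (∏ _a ∈ F', q) * ∏ a ∈ P \ F', (if a ∈ F then (0 : ℝ) else 1 - q)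
      = q ^ F'.card * (1 - q) ^ (P \ F').card * if F ⊆ ∅ ∪ F' then 1 else 0 := by
    intro F' _
    rw [Finset.empty_union, Finset.prod_const]
    split_ifs with h
    · rw [Finset.prod_congr rfl fun a ha => if_neg fun haF => (Finset.mem_sdiff.1 ha).2 (h haF),
        Finset.prod_const, mul_one]
    · obtain ⟨a, haF, haF'⟩ := Finset.not_subset.1 h
      have h4 : ∏ a ∈ P \ F', (if a ∈ F then (0 : ℝ) else 1 - q) = 0 :=
        Finset.prod_eq_zero (Finset.mem_sdiff.2 ⟨hF haF, by simpa using haF'⟩) (if_pos haF)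
      rw [h4, mul_zero, mul_zero]
  rw [← Finset.sum_congr rfl h3, ← h2]
  calc ∏ a ∈ P, (q + if a ∈ F then 0 else 1 - q) = ∏ a ∈ P, (if a ∈ F then q else 1) :=
        Finset.prod_congr rfl fun a _ => by split_ifs <;> ring
    _ = _ := by
      rw [Finset.prod_ite, Finset.prod_const, Finset.prod_const_one, mul_one,
        Finset.filter_mem_eq_inter, Finset.inter_eq_right.2 hF]

end Poissonization

/-! ### The two random graph models -/

section Models

open scoped Classical in
theorem setBernoulli_real_eq_sum {ι : Type*} [Fintype ι] [DecidableEq ι] (u : Finset ι)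
    (p : unitInterval)
    (A : Set (Set ι)) :
    (setBernoulli (u : Set ι) p).real A = ∑ F ∈ u.powerset,
      (p : ℝ) ^ F.card * (1 - p : ℝ) ^ (u \ F).card * (if (F : Set ι) ∈ A then 1 else 0) := by
  have hA : (A.toFinset : Set (Set ι)) = A := by simp
  rw [← hA, ← sum_measureReal_singleton]
  simp only [hA]
  have h1 : ∑ x ∈ A.toFinset, (setBernoulli (u : Set ι) p).real {x}
      = ∑ x : Set ι, if x ∈ A then (setBernoulli (u : Set ι) p).real {x} else 0 := by
    rw [← Finset.sum_filter]
    congr 1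
    ext; simp
  have h2 : ∑ x : Set ι, (if x ∈ A then (setBernoulli (u : Set ι) p).real {x} else 0)
      = ∑ F : Finset ι, if (F : Set ι) ∈ A then (setBernoulli (u : Set ι) p).real {(F : Set ι)}
        else 0 :=
    (Fintype.sum_equiv Fintype.finsetEquivSet _ _ fun F => by simp; rfl).symm
  rw [h1, h2, ← Finset.sum_subset (Finset.subset_univ u.powerset)]
  · refine Finset.sum_congr rfl fun F hF => ?_
    have hFu : (F : Set ι) ⊆ u := by simpa using hF
    rw [setBernoulli_real_singleton p hFu u.finite_toSet]
    have h3 : ((u : Set ι) \ F).ncard = (u \ F).card := by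
      rw [← Finset.coe_sdiff, Set.ncard_coe_finset]
    rw [h3, Set.ncard_coe_finset]
    split_ifs <;> simp
  · intro F _ hF
    have hFu : ¬ (F : Set ι) ⊆ u := by simpa using hF
    rw [measureReal_def, setBernoulli_singleton_of_not_subset p hFu]
    simp

variable {V : Type*} [DecidableEq V]

/-- The pairs of distinct vertices. -/
def pairs (V : Type*) [Fintype V] [DecidableEq V] : Finset (Sym2 V) :=
  Finset.univ.filter fun e => ¬ e.IsDiag

/-- The pairs of distinct vertices of `S`: the edges of the clique on `S`. -/
def cliqueEdges (S : Finset V) : Finset (Sym2 V) := S.sym2.filter fun e => ¬ e.IsDiag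

theorem mem_cliqueEdges {S : Finset V} {e : Sym2 V} :
    e ∈ cliqueEdges S ↔ (∀ v ∈ e, v ∈ S) ∧ ¬ e.IsDiag := by
  simp [cliqueEdges, Finset.mem_sym2_iff]

theorem mk_mem_cliqueEdges {S : Finset V} {u v : V} :
    s(u, v) ∈ cliqueEdges S ↔ u ∈ S ∧ v ∈ S ∧ u ≠ v := by
  simp [mem_cliqueEdges, and_assoc]

theorem card_cliqueEdges (S : Finset V) : (cliqueEdges S).card = S.card.choose 2 := by
  rw [← Sym2.card_image_offDiag]
  congr 1
  ext e
  induction e with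
  | h u v =>
    rw [mk_mem_cliqueEdges]
    simp only [Finset.mem_image, Finset.mem_offDiag, Prod.exists]
    constructor
    · rintro ⟨hu, hv, h⟩
      exact ⟨u, v, ⟨hu, hv, h⟩, rfl⟩
    · rintro ⟨a, b, ⟨ha, hb, h⟩, h'⟩
      rcases Sym2.eq_iff.1 h' with ⟨rfl, rfl⟩ | ⟨rfl, rfl⟩
      · exact ⟨ha, hb, h⟩
      · exact ⟨hb, ha, h.symm⟩

variable [Fintype V]

theorem mem_pairs {e : Sym2 V} : e ∈ pairs V ↔ ¬ e.IsDiag := by simp [pairs]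

theorem cliqueEdges_subset_pairs (S : Finset V) : cliqueEdges S ⊆ pairs V := fun _ he =>
  mem_pairs.2 (mem_cliqueEdges.1 he).2

theorem card_pairs : (pairs V).card = (Fintype.card V).choose 2 := by
  rw [← Finset.card_univ, ← card_cliqueEdges]
  congr 1

/-- The operator of a single object: it is assigned to a random set `S` of vertices, and adds the
edges of the clique on `S`. -/
def objectStep (V : Type*) [Fintype V] [DecidableEq V] (p : ℝ) :
    Module.End ℝ (Finset (Sym2 V) → ℝ) :=
  ∑ S : Finset V, (p ^ S.card * (1 - p) ^ (Fintype.card V - S.card)) • addSet (cliqueEdges S)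

omit [DecidableEq V] in
theorem sum_objectStep_weight (p : ℝ) :
    ∑ S : Finset V, p ^ S.card * (1 - p) ^ (Fintype.card V - S.card) = 1 := by
  rw [Fintype.sum_pow_mul_eq_add_pow, add_sub_cancel, one_pow]

theorem isRandomUnion_objectStep {p : ℝ} (h0 : 0 ≤ p) (h1 : p ≤ 1) :
    IsRandomUnion (objectStep V p) :=
  isRandomUnion_sum _ _ _
    (fun _ _ => mul_nonneg (pow_nonneg h0 _) (pow_nonneg (sub_nonneg.2 h1) _))
    (sum_objectStep_weight p)

theorem objectStep_apply_sub (p : ℝ) (f : Finset (Sym2 V) → ℝ) :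
    objectStep V p f - f = ∑ S : Finset V,
      (p ^ S.card * (1 - p) ^ (Fintype.card V - S.card)) • (addSet (cliqueEdges S) f - f) := by
  simp only [smul_sub, Finset.sum_sub_distrib, ← Finset.sum_smul, sum_objectStep_weight, one_smul,
    objectStep, LinearMap.sum_apply, LinearMap.smul_apply]

open scoped Classical in
/-- The indicator of a set of graphs as a function of the set of edges. -/
def graphIndicator (B : Set (SimpleGraph V)) (F : Finset (Sym2 V)) : ℝ :=
  if SimpleGraph.fromEdgeSet (F : Set (Sym2 V)) ∈ B then 1 else 0

omit [DecidableEq V] in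
theorem measurableSet_graphs (B : Set (SimpleGraph V)) : MeasurableSet B := by
  rw [← SimpleGraph.measurableEmbedding_edgeSet.measurableSet_image]
  exact (Set.toFinite _).measurableSet

theorem asProb_coe {q : ℝ} (h0 : 0 ≤ q) (h1 : q ≤ 1) : (asProb q : ℝ) = q := by
  rw [asProb, Set.projIcc_of_mem zero_le_one ⟨h0, h1⟩]

theorem probGnp_eq_noise (n : ℕ) {q : ℝ} (h0 : 0 ≤ q) (h1 : q ≤ 1)
    (B : Set (SimpleGraph (Fin n))) :
    probGnp n q B = noise q (pairs (Fin n)) (graphIndicator B) ∅ := by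
  classical
  have hu : ((pairs (Fin n) : Finset (Sym2 (Fin n))) : Set (Sym2 (Fin n))) = Sym2.diagSetᶜ := by
    ext e; simp [pairs]
  rw [probGnp, SimpleGraph.binomialRandom_eq_map, measureReal_def,
    Measure.map_apply (measurable_of_countable _) (measurableSet_graphs B),
    ← measureReal_def, ← hu, setBernoulli_real_eq_sum, noise_apply, asProb_coe h0 h1]
  refine Finset.sum_congr rfl fun F _ => ?_
  simp only [Finset.empty_union, graphIndicator, Set.mem_preimage]

theorem objectStep_pow_apply (p : ℝ) (m : ℕ) (f : Finset (Sym2 V) → ℝ) :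
    (objectStep V p ^ m) f ∅ = ∑ φ : Fin m → Finset V,
      (∏ w, p ^ (φ w).card * (1 - p) ^ (Fintype.card V - (φ w).card))
        * f (Finset.univ.biUnion fun w => cliqueEdges (φ w)) := by
  have hf : f ∈ Submodule.span ℝ
      (Set.range (subsetIndicator : Finset (Sym2 V) → Finset (Sym2 V) → ℝ)) := by
    rw [span_subsetIndicator]; trivial
  induction hf using Submodule.span_induction with
  | mem f hf =>
    obtain ⟨S, rfl⟩ := hf
    set c : ℝ := ∑ A : Finset V, p ^ A.card * (1 - p) ^ (Fintype.card V - A.card)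
      * subsetIndicator S (cliqueEdges A) with hc
    have h1 : objectStep V p (subsetIndicator S) = c • subsetIndicator S := by
      simp only [objectStep, LinearMap.sum_apply, LinearMap.smul_apply, addSet_subsetIndicator,
        smul_smul, ← Finset.sum_smul, hc]
    have h2 : (objectStep V p ^ m) (subsetIndicator S) = c ^ m • subsetIndicator S := by
      induction m with
      | zero => simp
      | succ k ih =>
        rw [pow_succ', Module.End.mul_apply, ih, map_smul, h1, smul_smul, pow_succ]
    rw [h2, hc, Fintype.sum_pow]
    simp only [Pi.smul_apply, smul_eq_mul, Finset.prod_mul_distrib]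
    have h3 : subsetIndicator S (∅ : Finset (Sym2 V)) = 1 := by simp [subsetIndicator]
    rw [h3, mul_one]
    refine Finset.sum_congr rfl fun φ _ => ?_
    congr 1
    simp only [subsetIndicator, Finset.biUnion_subset, Finset.mem_univ, forall_true_left]
    rw [Finset.prod_ite_zero]
    simp
  | zero => simp
  | add f f' _ _ h h' => simp only [map_add, Pi.add_apply, h, h', mul_add, Finset.sum_add_distrib]
  | smul a f _ h =>
    simp only [map_smul, Pi.smul_apply, smul_eq_mul, h, Finset.mul_sum]
    exact Finset.sum_congr rfl fun φ _ => by ring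

/-- An assignment of vertex sets to objects, as a relation between vertices and objects. -/
def assignmentEquiv (V W : Type*) [Fintype V] [Fintype W] [DecidableEq V] [DecidableEq W] :
    (W → Finset V) ≃ Finset (V × W) where
  toFun φ := Finset.univ.filter fun x => x.1 ∈ φ x.2
  invFun R w := Finset.univ.filter fun v => (v, w) ∈ R
  left_inv φ := by ext; simp
  right_inv R := by ext; simp

theorem card_assignmentEquiv {W : Type*} [Fintype W] [DecidableEq W] (φ : W → Finset V) :
    (assignmentEquiv V W φ).card = ∑ w, (φ w).card := by
  simp only [assignmentEquiv, Equiv.coe_fn_mk, Finset.card_filter, Fintype.sum_prod_type_right]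
  simp

/-- The intersection graph is the union of the cliques of `m` independent objects. -/
theorem probGnmp_eq_objectStep (n m : ℕ) {p : ℝ} (h0 : 0 ≤ p) (h1 : p ≤ 1)
    (B : Set (SimpleGraph (Fin n))) :
    probGnmp n m p B = (objectStep (Fin n) p ^ m) (graphIndicator B) ∅ := by
  classical
  rw [probGnmp, randomIntersectionGraph, measureReal_def,
    Measure.map_apply (measurable_intersectionGraph n m) (measurableSet_graphs B),
    ← measureReal_def, ← Finset.coe_univ, setBernoulli_real_eq_sum, objectStep_pow_apply,
    asProb_coe h0 h1, Finset.powerset_univ]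
  refine (Fintype.sum_equiv (assignmentEquiv (Fin n) (Fin m)) _ _ fun φ => ?_).symm
  have h2 : intersectionGraph
        ((assignmentEquiv (Fin n) (Fin m) φ : Finset (Fin n × Fin m)) : Set (Fin n × Fin m))
      = SimpleGraph.fromEdgeSet
        ((Finset.univ.biUnion fun w => cliqueEdges (φ w) : Finset (Sym2 (Fin n))) :
          Set (Sym2 (Fin n))) := by
    ext u v
    simp only [intersectionGraph, assignmentEquiv, Equiv.coe_fn_mk, Finset.coe_filter,
      Set.mem_ofPred_eq, Finset.mem_univ, true_and, SimpleGraph.fromEdgeSet_adj, Finset.mem_coe,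
      Finset.mem_biUnion, mk_mem_cliqueEdges]
    constructor
    · rintro ⟨h, w, hu, hv⟩
      exact ⟨⟨w, hu, hv, h⟩, h⟩
    · rintro ⟨⟨w, hu, hv, h⟩, -⟩
      exact ⟨h, w, hu, hv⟩
  simp only [graphIndicator, Set.mem_preimage, h2]
  congr 1
  rw [Finset.prod_mul_distrib, Finset.prod_pow_eq_pow_sum, Finset.prod_pow_eq_pow_sum,
    card_assignmentEquiv, ← Finset.compl_eq_univ_sdiff, Finset.card_compl, card_assignmentEquiv]
  have h3 : ∑ w, (Fintype.card (Fin n) - (φ w).card)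
      = Fintype.card (Fin n × Fin m) - ∑ w, (φ w).card := by
    rw [Finset.sum_tsub_distrib _ fun w _ => Finset.card_le_univ _]
    simp [mul_comm]
  rw [h3]

end Models

/-! ### Replacing one object by single edges -/

section OneObject

variable {V : Type*} [DecidableEq V]

theorem sum_powersetCard_prod_le {ι : Type*} [DecidableEq ι] (A : Finset ι) {z : ι → ℝ}
    (hz : ∀ i, 0 ≤ z i) (j : ℕ) :
    ∑ W ∈ A.powersetCard j, ∏ w ∈ W, z w ≤ (∑ w ∈ A, z w) ^ j := by
  induction A using Finset.induction_on generalizing j with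
  | empty =>
    cases j with
    | zero => simp
    | succ j => rw [Finset.powersetCard_eq_empty.2 (by simp)]; simp
  | insert a A ha ih =>
    cases j with
    | zero => simp
    | succ j =>
      have hZ : 0 ≤ ∑ w ∈ A, z w := Finset.sum_nonneg fun i _ => hz i
      have hinj : Set.InjOn (insert a) (A.powersetCard j : Set (Finset ι)) := by
        intro W hW W' hW' h
        have h1 : a ∉ W := fun h => ha ((Finset.mem_powersetCard.1 hW).1 h)
        have h2 : a ∉ W' := fun h => ha ((Finset.mem_powersetCard.1 hW').1 h)
        rw [← Finset.erase_insert h1, ← Finset.erase_insert h2, h]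
      have hdis : Disjoint (A.powersetCard (j + 1)) ((A.powersetCard j).image (insert a)) := by
        rw [Finset.disjoint_left]
        intro W hW hW'
        obtain ⟨W', _, rfl⟩ := Finset.mem_image.1 hW'
        exact ha ((Finset.mem_powersetCard.1 hW).1 (Finset.mem_insert_self _ _))
      rw [Finset.powersetCard_succ_insert ha, Finset.sum_union hdis, Finset.sum_image hinj,
        Finset.sum_insert ha]
      have h3 : ∑ W ∈ A.powersetCard j, ∏ w ∈ insert a W, z w
          = z a * ∑ W ∈ A.powersetCard j, ∏ w ∈ W, z w := by
        rw [Finset.mul_sum]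
        refine Finset.sum_congr rfl fun W hW => Finset.prod_insert fun h =>
          ha ((Finset.mem_powersetCard.1 hW).1 h)
      rw [h3]
      calc _ ≤ (∑ w ∈ A, z w) ^ (j + 1) + z a * (∑ w ∈ A, z w) ^ j :=
            add_le_add (ih _) (mul_le_mul_of_nonneg_left (ih _) (hz a))
        _ = (z a + ∑ w ∈ A, z w) * (∑ w ∈ A, z w) ^ j := by ring
        _ ≤ (z a + ∑ w ∈ A, z w) * (z a + ∑ w ∈ A, z w) ^ j :=
            mul_le_mul_of_nonneg_left
              (pow_le_pow_left₀ hZ (le_add_of_nonneg_left (hz a)) _) (add_nonneg (hz a) hZ)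
        _ = _ := by ring

variable [Fintype V]

/-- The probability that an object is held by at least `k` vertices is at most `(n * p) ^ k`. -/
theorem sum_card_ge_le {p : ℝ} (h0 : 0 ≤ p) (h1 : p ≤ 1) (k : ℕ) :
    ∑ S : Finset V with k ≤ S.card, p ^ S.card * (1 - p) ^ (Fintype.card V - S.card)
      ≤ (Fintype.card V * p) ^ k := by
  have hw : ∀ S : Finset V, 0 ≤ p ^ S.card * (1 - p) ^ (Fintype.card V - S.card) := fun S =>
    mul_nonneg (pow_nonneg h0 _) (pow_nonneg (sub_nonneg.2 h1) _)
  have h2 : ∀ T : Finset V, ∑ S : Finset V, (p ^ S.card * (1 - p) ^ (Fintype.card V - S.card))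
      * (if T ⊆ S then 1 else 0) = p ^ T.card := by
    intro T
    rw [← noise_superset (q := p) (Finset.subset_univ T), noise_apply, Finset.powerset_univ]
    refine Finset.sum_congr rfl fun S _ => ?_
    rw [← Finset.compl_eq_univ_sdiff, Finset.card_compl, Finset.empty_union]
  calc _ ≤ ∑ S : Finset V, ∑ T ∈ Finset.univ.powersetCard k,
        (p ^ S.card * (1 - p) ^ (Fintype.card V - S.card)) * (if T ⊆ S then 1 else 0) := by
        rw [Finset.sum_filter]
        refine Finset.sum_le_sum fun S _ => ?_
        have h3 : ∀ T ∈ (Finset.univ : Finset V).powersetCard k,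
            0 ≤ (p ^ S.card * (1 - p) ^ (Fintype.card V - S.card))
              * (if T ⊆ S then 1 else 0) := fun T _ =>
          mul_nonneg (hw S) (by split_ifs <;> norm_num)
        split_ifs with hk
        · obtain ⟨T, hTS, hT⟩ := Finset.exists_subset_card_eq hk
          refine le_trans ?_ (Finset.single_le_sum h3
            (Finset.mem_powersetCard.2 ⟨Finset.subset_univ T, hT⟩))
          rw [if_pos hTS, mul_one]
        · exact Finset.sum_nonneg h3
    _ = ∑ T ∈ (Finset.univ : Finset V).powersetCard k, p ^ k := by
        rw [Finset.sum_comm]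
        refine Finset.sum_congr rfl fun T hT => ?_
        rw [h2, (Finset.mem_powersetCard.1 hT).2]
    _ = ((Fintype.card V).choose k : ℝ) * p ^ k := by
        rw [Finset.sum_const, Finset.card_powersetCard, Finset.card_univ, nsmul_eq_mul]
    _ ≤ _ := by
        rw [mul_pow]
        refine mul_le_mul_of_nonneg_right ?_ (pow_nonneg h0 _)
        exact_mod_cast Nat.choose_le_pow _ _

/-- The total cost, over all vertices `w`, of forcing both edges from `w` to the pair `u`, `v`. -/
def cherryCost (r : ℝ) (x : Finset (Sym2 V)) (u v : V) : ℝ :=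
  ∑ w ∈ Finset.univ \ {u, v}, energyCost r x s(u, w) * energyCost r x s(v, w)

omit [Fintype V] in
/-- The cost of forcing all edges of a clique except `s(u, v)` is at most the cost for the pairs
outside `{u, v}` in the worst case, times the costs of the pairs that meet `{u, v}`. -/
theorem prod_energyCost_clique_le {r : ℝ} (h0 : 0 < r) (h1 : r ≤ 1) (x : Finset (Sym2 V))
    {u v : V} (S : Finset V) :
    ∏ a ∈ (cliqueEdges S).erase s(u, v), energyCost r x a
      ≤ r⁻¹ ^ (S \ {u, v}).card.choose 2
        * ∏ w ∈ S \ {u, v}, (energyCost r x s(u, w) * energyCost r x s(v, w)) := by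
  set W := S \ {u, v} with hW
  have hc := fun a => one_le_energyCost h0 h1 x a
  have hc0 : ∀ a, 0 ≤ energyCost r x a := fun a => zero_le_one.trans (hc a)
  have hinj : ∀ z : V, Set.InjOn (fun w => s(z, w)) (W : Set V) := by
    intro z a _ b _ hab
    exact Sym2.congr_right.1 hab
  have hsub : (cliqueEdges S).erase s(u, v)
      ⊆ cliqueEdges W ∪ (W.image (fun w => s(u, w)) ∪ W.image (fun w => s(v, w))) := by
    intro e
    induction e with
    | h a b =>
      simp only [Finset.mem_erase, Finset.mem_union, mk_mem_cliqueEdges, Finset.mem_image, hW,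
        Finset.mem_sdiff, Finset.mem_insert, Finset.mem_singleton, Sym2.eq_iff, ne_eq]
      rintro ⟨hne, ha, hb, hab⟩
      by_cases h1 : a = u
      · subst h1
        refine Or.inr (Or.inl ⟨b, ⟨hb, ?_⟩, Or.inl ⟨rfl, rfl⟩⟩)
        rintro (rfl | rfl)
        · exact hab rfl
        · exact hne (Or.inl ⟨rfl, rfl⟩)
      by_cases h2 : a = v
      · subst h2
        refine Or.inr (Or.inr ⟨b, ⟨hb, ?_⟩, Or.inl ⟨rfl, rfl⟩⟩)
        rintro (rfl | rfl)
        · exact hne (Or.inr ⟨rfl, rfl⟩)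
        · exact hab rfl
      by_cases h3 : b = u
      · subst h3
        exact Or.inr (Or.inl ⟨a, ⟨ha, by tauto⟩, Or.inr ⟨rfl, rfl⟩⟩)
      by_cases h4 : b = v
      · subst h4
        exact Or.inr (Or.inr ⟨a, ⟨ha, by tauto⟩, Or.inr ⟨rfl, rfl⟩⟩)
      exact Or.inl ⟨⟨ha, by tauto⟩, ⟨hb, by tauto⟩, hab⟩
  have hunion : ∀ A B : Finset (Sym2 V), ∏ a ∈ A ∪ B, energyCost r x a
      ≤ (∏ a ∈ A, energyCost r x a) * ∏ a ∈ B, energyCost r x a := by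
    intro A B
    rw [← Finset.prod_union_inter]
    exact le_mul_of_one_le_right (Finset.prod_nonneg fun a _ => hc0 a)
      (Finset.one_le_prod fun a _ => hc a)
  have hle : ∀ a, energyCost r x a ≤ r⁻¹ := by
    intro a
    unfold energyCost
    split_ifs
    · exact le_rfl
    · exact (one_le_inv₀ h0).2 h1
  calc _ ≤ ∏ a ∈ cliqueEdges W ∪ (W.image (fun w => s(u, w)) ∪ W.image (fun w => s(v, w))),
        energyCost r x a :=
        Finset.prod_le_prod_of_subset_of_one_le hsub (fun a _ => hc0 a) fun a _ _ => hc a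
    _ ≤ (∏ a ∈ cliqueEdges W, energyCost r x a)
        * ((∏ a ∈ W.image (fun w => s(u, w)), energyCost r x a)
          * ∏ a ∈ W.image (fun w => s(v, w)), energyCost r x a) :=
        (hunion _ _).trans (mul_le_mul_of_nonneg_left (hunion _ _)
          (Finset.prod_nonneg fun a _ => hc0 a))
    _ ≤ _ := by
        rw [Finset.prod_image (hinj u), Finset.prod_image (hinj v), ← Finset.prod_mul_distrib]
        refine mul_le_mul_of_nonneg_right ?_
          (Finset.prod_nonneg fun w _ => mul_nonneg (hc0 _) (hc0 _))
        calc _ ≤ ∏ a ∈ cliqueEdges W, r⁻¹ :=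
              Finset.prod_le_prod (fun a _ => hc0 a) fun a _ => hle a
          _ = _ := by rw [Finset.prod_const, card_cliqueEdges]

/-- The total cost of the cliques on at most `J + 2` vertices through the pair `u`, `v`, weighted by
the probability of the clique, sorted by the number `j` of its further vertices. -/
theorem sum_cliques_cost_le {p r : ℝ} (hp : 0 ≤ p) (h0 : 0 < r) (h1 : r ≤ 1)
    (x : Finset (Sym2 V)) {u v : V} (huv : u ≠ v) (J : ℕ) :
    ∑ S : Finset V with s(u, v) ∈ cliqueEdges S ∧ S.card ≤ J + 2,
        p ^ S.card * ∏ a ∈ (cliqueEdges S).erase s(u, v), energyCost r x a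
      ≤ p ^ 2 * ∑ j ∈ Finset.range (J + 1),
        (p * cherryCost r x u v) ^ j * r⁻¹ ^ j.choose 2 := by
  set A : Finset V := Finset.univ \ {u, v} with hA
  set z : V → ℝ := fun w => energyCost r x s(u, w) * energyCost r x s(v, w) with hz
  have hz0 : ∀ w, 0 ≤ z w := fun w =>
    mul_nonneg (zero_le_one.trans (one_le_energyCost h0 h1 x _))
      (zero_le_one.trans (one_le_energyCost h0 h1 x _))
  set G : Finset V → ℝ := fun W =>
    p ^ (W.card + 2) * (r⁻¹ ^ W.card.choose 2 * ∏ w ∈ W, z w) with hG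
  have hcard : ∀ S : Finset V, s(u, v) ∈ cliqueEdges S → (S \ {u, v}).card + 2 = S.card := by
    intro S hS
    rw [mk_mem_cliqueEdges] at hS
    have h2 : ({u, v} : Finset V) ⊆ S := by
      simp [Finset.insert_subset_iff, hS.1, hS.2.1]
    rw [Finset.card_sdiff_of_subset h2, Finset.card_pair huv]
    have := Finset.card_le_card h2
    rw [Finset.card_pair huv] at this
    omega
  calc _ ≤ ∑ S : Finset V with s(u, v) ∈ cliqueEdges S ∧ S.card ≤ J + 2, G (S \ {u, v}) := by
        refine Finset.sum_le_sum fun S hS => ?_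
        have hS := (Finset.mem_filter.1 hS).2
        simp only [hG]
        rw [hcard S hS.1]
        exact mul_le_mul_of_nonneg_left (prod_energyCost_clique_le h0 h1 x S) (pow_nonneg hp _)
    _ = ∑ W ∈ A.powerset with W.card ≤ J, G W := by
        refine Finset.sum_nbij' (fun S => S \ {u, v}) (fun W => W ∪ {u, v}) ?_ ?_ ?_ ?_ ?_
        · intro S hS
          have hS := (Finset.mem_filter.1 hS).2
          rw [Finset.mem_filter, Finset.mem_powerset]
          refine ⟨Finset.sdiff_subset_sdiff (Finset.subset_univ _) subset_rfl, ?_⟩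
          have := hcard S hS.1
          omega
        · intro W hW
          rw [Finset.mem_filter, Finset.mem_powerset] at hW
          rw [Finset.mem_filter, mk_mem_cliqueEdges]
          refine ⟨Finset.mem_univ _, ⟨by simp, by simp, huv⟩, ?_⟩
          refine (Finset.card_union_le _ _).trans ?_
          rw [Finset.card_pair huv]
          omega
        · intro S hS
          have hS := (Finset.mem_filter.1 hS).2.1
          rw [mk_mem_cliqueEdges] at hS
          exact Finset.sdiff_union_of_subset (by simp [Finset.insert_subset_iff, hS.1, hS.2.1])
        · intro W hW
          rw [Finset.mem_filter, Finset.mem_powerset] at hW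
          refine Finset.union_sdiff_cancel_right ?_
          rw [Finset.disjoint_left]
          intro w hw
          exact (Finset.mem_sdiff.1 (hW.1 hw)).2
        · intro S _
          rfl
    _ = ∑ j ∈ Finset.range (J + 1), ∑ W ∈ A.powersetCard j, G W := by
        rw [← Finset.sum_fiberwise_of_maps_to (t := Finset.range (J + 1)) (g := Finset.card)
          fun W hW => by
            have := (Finset.mem_filter.1 hW).2
            exact Finset.mem_range.2 (by omega)]
        refine Finset.sum_congr rfl fun j hj => Finset.sum_congr ?_ fun _ _ => rfl
        have := Finset.mem_range.1 hj
        ext W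
        simp only [Finset.mem_filter, Finset.mem_powerset, Finset.mem_powersetCard]
        constructor
        · rintro ⟨⟨h, _⟩, h'⟩; exact ⟨h, h'⟩
        · rintro ⟨h, h'⟩; exact ⟨⟨h, by omega⟩, h'⟩
    _ ≤ ∑ j ∈ Finset.range (J + 1),
        p ^ (j + 2) * (r⁻¹ ^ j.choose 2 * (∑ w ∈ A, z w) ^ j) := by
        refine Finset.sum_le_sum fun j _ => ?_
        have : ∑ W ∈ A.powersetCard j, G W
            = p ^ (j + 2) * (r⁻¹ ^ j.choose 2 * ∑ W ∈ A.powersetCard j, ∏ w ∈ W, z w) := by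
          rw [Finset.mul_sum, Finset.mul_sum]
          refine Finset.sum_congr rfl fun W hW => ?_
          simp only [hG, (Finset.mem_powersetCard.1 hW).2]
        rw [this]
        have hr : 0 ≤ r⁻¹ := (inv_pos.2 h0).le
        exact mul_le_mul_of_nonneg_left (mul_le_mul_of_nonneg_left
          (sum_powersetCard_prod_le A hz0 j) (pow_nonneg hr _)) (pow_nonneg hp _)
    _ = _ := by
        rw [Finset.mul_sum]
        refine Finset.sum_congr rfl fun j _ => ?_
        rw [cherryCost, mul_pow]
        ring

/-- In the presence of the noise, an object can be replaced by single edges that appear with a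
slightly larger probability, at the cost of the probability that the object is assigned to too many
vertices. -/
theorem noise_objectStep_le {p r c : ℝ} (hp0 : 0 ≤ p) (hp1 : p ≤ 1) (h0 : 0 < r) (h1 : r ≤ 1)
    (J : ℕ) {f : Finset (Sym2 V) → ℝ} (hf : Monotone f) (hf0 : ∀ x, 0 ≤ f x) (hf1 : ∀ x, f x ≤ 1)
    (H : ∀ x u v, u ≠ v → f (x ∪ {s(u, v)}) ≠ f x →
      ∑ j ∈ Finset.range (J + 1), (p * cherryCost r x u v) ^ j * r⁻¹ ^ j.choose 2 ≤ 1 + c)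
    (g : Finset (Sym2 V)) :
    noise r (pairs V) (objectStep V p f) g
      ≤ noise r (pairs V) (singleStep ((1 + c) * p ^ 2) (pairs V) f) g
        + (Fintype.card V * p) ^ (J + 3) := by
  have hN := isRandomUnion_noise (pairs V) h0.le h1
  set N := noise r (pairs V) with hNdef
  set wt : Finset V → ℝ := fun S => p ^ S.card * (1 - p) ^ (Fintype.card V - S.card) with hwt
  have hwt0 : ∀ S, 0 ≤ wt S := fun S =>
    mul_nonneg (pow_nonneg hp0 _) (pow_nonneg (sub_nonneg.2 hp1) _)
  have hwtp : ∀ S, wt S ≤ p ^ S.card := fun S =>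
    mul_le_of_le_one_right (pow_nonneg hp0 _)
      (pow_le_one₀ (sub_nonneg.2 hp1) (sub_le_self _ hp0))
  set D : Sym2 V → Finset (Sym2 V) → ℝ := fun e x => f (x ∪ {e}) - f x with hD
  have hD0 : ∀ e x, 0 ≤ D e x := fun e x => sub_nonneg.2 (hf Finset.subset_union_left)
  set Q : Finset V → Sym2 V → Finset (Sym2 V) → ℝ := fun S e x =>
    D e x * ∏ a ∈ (cliqueEdges S).erase e, energyCost r x a with hQ
  have e1 : N (objectStep V p f) g - N f g
      = ∑ S : Finset V, wt S * N (addSet (cliqueEdges S) f - f) g := by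
    rw [← Pi.sub_apply, ← map_sub, objectStep_apply_sub]
    simp [map_sum, Finset.sum_apply, hwt]
  have e2 : N (singleStep ((1 + c) * p ^ 2) (pairs V) f) g - N f g
      = ∑ e ∈ pairs V, N (((1 + c) * p ^ 2) • D e) g := by
    rw [← Pi.sub_apply, ← map_sub]
    have : singleStep ((1 + c) * p ^ 2) (pairs V) f - f
        = ∑ e ∈ pairs V, ((1 + c) * p ^ 2) • D e := by
      ext x
      simp only [Pi.sub_apply, singleStep_apply, add_sub_cancel_left, Finset.mul_sum,
        Finset.sum_apply, Pi.smul_apply, smul_eq_mul, hD]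
    rw [this, map_sum, Finset.sum_apply]
  have big : ∑ S : Finset V with ¬ S.card ≤ J + 2, wt S * N (addSet (cliqueEdges S) f - f) g
      ≤ (Fintype.card V * p) ^ (J + 3) := by
    refine le_trans ?_ (sum_card_ge_le hp0 hp1 (J + 3))
    have : (Finset.univ.filter fun S : Finset V => ¬ S.card ≤ J + 2)
        = Finset.univ.filter fun S : Finset V => J + 3 ≤ S.card := by
      ext S; simp; omega
    rw [this]
    refine Finset.sum_le_sum fun S _ => mul_le_of_le_one_right (hwt0 S) ?_
    refine hN.apply_le_one (fun x => ?_) g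
    simp only [Pi.sub_apply, addSet_apply]
    linarith [hf0 x, hf1 (x ∪ cliqueEdges S)]
  have small : ∑ S : Finset V with S.card ≤ J + 2, wt S * N (addSet (cliqueEdges S) f - f) g
      ≤ ∑ e ∈ pairs V, N (((1 + c) * p ^ 2) • D e) g := by
    calc _ ≤ ∑ S : Finset V with S.card ≤ J + 2, ∑ e ∈ cliqueEdges S,
          N (p ^ S.card • Q S e) g := by
          refine Finset.sum_le_sum fun S _ => ?_
          have h3 := noise_addSet_sub_le (pairs V) h0 h1 (cliqueEdges_subset_pairs S) hf g
          have h4 : 0 ≤ N (addSet (cliqueEdges S) f - f) g :=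
            hN.nonneg_apply (fun x => sub_nonneg.2 (hf Finset.subset_union_left)) g
          refine (mul_le_mul (hwtp S) h3 h4 (pow_nonneg hp0 _)).trans_eq ?_
          simp only [map_smul, Pi.smul_apply, smul_eq_mul, Finset.mul_sum, hQ, hD, hNdef]
      _ = ∑ e ∈ pairs V, ∑ S : Finset V with e ∈ cliqueEdges S ∧ S.card ≤ J + 2,
          N (p ^ S.card • Q S e) g := by
          refine Finset.sum_comm' fun S e => ?_
          simp only [Finset.mem_filter, Finset.mem_univ, true_and]
          exact ⟨fun h => ⟨⟨h.2, h.1⟩, cliqueEdges_subset_pairs S h.2⟩, fun h => ⟨h.1.2, h.1.1⟩⟩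
      _ ≤ _ := by
          refine Finset.sum_le_sum fun e he => ?_
          rw [← Finset.sum_apply, ← map_sum]
          refine hN.mono (fun x => ?_) g
          simp only [Finset.sum_apply, Pi.smul_apply, smul_eq_mul, hQ]
          by_cases hpiv : f (x ∪ {e}) = f x
          · have hDx : D e x = 0 := sub_eq_zero.2 hpiv
            simp [hDx]
          induction e with
          | h u v =>
            have huv : u ≠ v := by simpa [mem_pairs] using he
            have h5 := sum_cliques_cost_le hp0 h0 h1 x huv J
            have h6 := H x u v huv hpiv
            calc _ = D s(u, v) x * ∑ S : Finset V with s(u, v) ∈ cliqueEdges S ∧ S.card ≤ J + 2,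
                    p ^ S.card * ∏ a ∈ (cliqueEdges S).erase s(u, v), energyCost r x a := by
                  rw [Finset.mul_sum]
                  exact Finset.sum_congr rfl fun S _ => by ring
              _ ≤ D s(u, v) x * (p ^ 2 * (1 + c)) :=
                  mul_le_mul_of_nonneg_left (h5.trans (mul_le_mul_of_nonneg_left h6 (sq_nonneg p)))
                    (hD0 _ _)
              _ = _ := by ring
  have e3 := Finset.sum_filter_add_sum_filter_not (Finset.univ : Finset (Finset V))
    (fun S => S.card ≤ J + 2) fun S => wt S * N (addSet (cliqueEdges S) f - f) g
  linarith

end OneObject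

/-! ### Large degrees and codegrees -/

section Codegrees

variable {V : Type*} [DecidableEq V]

/-- The edges from `u` to the vertices of `W`. -/
def starEdges (u : V) (W : Finset V) : Finset (Sym2 V) := W.image fun w => s(u, w)

theorem card_starEdges (u : V) (W : Finset V) : (starEdges u W).card = W.card :=
  Finset.card_image_of_injective _ fun _ _ h => Sym2.congr_right.1 h

theorem card_starEdges_union {u v : V} (huv : u ≠ v) {W : Finset V} (hu : u ∉ W) :
    (starEdges u W ∪ starEdges v W).card = 2 * W.card := by
  rw [Finset.card_union_of_disjoint, card_starEdges, card_starEdges, two_mul]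
  rw [Finset.disjoint_left]
  intro e he he'
  obtain ⟨w, _, rfl⟩ := Finset.mem_image.1 he
  obtain ⟨w', hw', h⟩ := Finset.mem_image.1 he'
  rcases Sym2.eq_iff.1 h with ⟨h1, _⟩ | ⟨_, h2⟩
  · exact huv h1.symm
  · exact hu (h2 ▸ hw')

variable [Fintype V]

theorem starEdges_subset_pairs {u : V} {W : Finset V} (hu : u ∉ W) : starEdges u W ⊆ pairs V := by
  intro e he
  obtain ⟨w, hw, rfl⟩ := Finset.mem_image.1 he
  rw [mem_pairs, Sym2.mk_isDiag_iff]
  rintro rfl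
  exact hu hw

/-- The edge set `x` has a vertex of degree at least `D₁` or a pair of vertices of codegree at least
`D₂`. -/
def HasLargeDegree (D₁ D₂ : ℕ) (x : Finset (Sym2 V)) : Prop :=
  (∃ u, ∃ W ∈ (Finset.univ \ {u}).powersetCard D₁, starEdges u W ⊆ x) ∨
    ∃ u v, u ≠ v ∧ ∃ W ∈ (Finset.univ \ {u, v}).powersetCard D₂,
      starEdges u W ∪ starEdges v W ⊆ x

theorem HasLargeDegree.mono {D₁ D₂ : ℕ} {x y : Finset (Sym2 V)} (hxy : x ⊆ y)
    (h : HasLargeDegree D₁ D₂ x) : HasLargeDegree D₁ D₂ y := by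
  rcases h with ⟨u, W, hW, h⟩ | ⟨u, v, huv, W, hW, h⟩
  · exact Or.inl ⟨u, W, hW, h.trans hxy⟩
  · exact Or.inr ⟨u, v, huv, W, hW, h.trans hxy⟩

/-- Edges that are absent cost nothing, so bounded degrees and codegrees bound the cost. -/
theorem cherryCost_le {r : ℝ} (h0 : 0 < r) (h1 : r ≤ 1) {D₁ D₂ : ℕ} {x : Finset (Sym2 V)}
    (hx : ¬ HasLargeDegree D₁ D₂ x) {u v : V} (huv : u ≠ v) {d₁ d₂ : ℝ}
    (hd₁ : ∀ k < D₁, (k : ℝ) ≤ d₁) (hd₂ : ∀ k < D₂, (k : ℝ) ≤ d₂) :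
    cherryCost r x u v ≤ Fintype.card V + 2 * d₁ * r⁻¹ + d₂ * r⁻¹ ^ 2 := by
  rw [HasLargeDegree, not_or] at hx
  push Not at hx
  have hr : 1 ≤ r⁻¹ := (one_le_inv₀ h0).2 h1
  have hr0 : 0 ≤ r⁻¹ := zero_le_one.trans hr
  set A : Finset V := Finset.univ \ {u, v} with hA
  have hdeg : ∀ z : V, z ∈ ({u, v} : Finset V) →
      ((A.filter fun w => s(z, w) ∈ x).card : ℝ) ≤ d₁ := by
    intro z hz
    apply hd₁
    by_contra! hlt
    obtain ⟨W, hWs, hW⟩ := Finset.exists_subset_card_eq hlt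
    refine hx.1 z W (Finset.mem_powersetCard.2 ⟨fun w hw => ?_, hW⟩) fun e he => ?_
    · have h2 := (Finset.mem_sdiff.1 (Finset.mem_filter.1 (hWs hw)).1).2
      rw [Finset.mem_sdiff, Finset.mem_singleton]
      refine ⟨Finset.mem_univ _, ?_⟩
      rintro rfl
      exact h2 hz
    · obtain ⟨w, hw, rfl⟩ := Finset.mem_image.1 he
      exact (Finset.mem_filter.1 (hWs hw)).2
  have hcodeg : ((A.filter fun w => s(u, w) ∈ x ∧ s(v, w) ∈ x).card : ℝ) ≤ d₂ := by
    apply hd₂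
    by_contra! hlt
    obtain ⟨W, hWs, hW⟩ := Finset.exists_subset_card_eq hlt
    refine hx.2 u v huv W (Finset.mem_powersetCard.2 ⟨fun w hw => ?_, hW⟩) fun e he => ?_
    · exact (Finset.mem_filter.1 (hWs hw)).1
    · rcases Finset.mem_union.1 he with he | he
      · obtain ⟨w, hw, rfl⟩ := Finset.mem_image.1 he
        exact (Finset.mem_filter.1 (hWs hw)).2.1
      · obtain ⟨w, hw, rfl⟩ := Finset.mem_image.1 he
        exact (Finset.mem_filter.1 (hWs hw)).2.2
  have hu := hdeg u (by simp)
  have hv := hdeg v (by simp)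
  rw [Finset.card_filter] at hu hv hcodeg
  push_cast at hu hv hcodeg
  have hAc : (A.card : ℝ) ≤ Fintype.card V := by exact_mod_cast Finset.card_le_univ _
  calc cherryCost r x u v ≤ ∑ w ∈ A, (1 + ((if s(u, w) ∈ x then (1 : ℝ) else 0)
        + (if s(v, w) ∈ x then (1 : ℝ) else 0)) * r⁻¹
        + (if s(u, w) ∈ x ∧ s(v, w) ∈ x then (1 : ℝ) else 0) * r⁻¹ ^ 2) := by
        refine Finset.sum_le_sum fun w _ => ?_
        unfold energyCost
        by_cases h2 : s(u, w) ∈ x <;> by_cases h3 : s(v, w) ∈ x <;>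
          simp [h2, h3, -inv_pow] <;> nlinarith
    _ = A.card + ((∑ w ∈ A, if s(u, w) ∈ x then (1 : ℝ) else 0)
        + ∑ w ∈ A, if s(v, w) ∈ x then (1 : ℝ) else 0) * r⁻¹
        + (∑ w ∈ A, if s(u, w) ∈ x ∧ s(v, w) ∈ x then (1 : ℝ) else 0) * r⁻¹ ^ 2 := by
        simp only [Finset.sum_add_distrib, ← Finset.sum_mul, Finset.sum_const, nsmul_eq_mul,
          mul_one]
    _ ≤ Fintype.card V + (d₁ + d₁) * r⁻¹ + d₂ * r⁻¹ ^ 2 := by gcongr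
    _ = _ := by ring

theorem choose_mul_pow_le (n : ℕ) {D : ℕ} (hD : 0 < D) {y : ℝ} (hy : 0 ≤ y) :
    (n.choose D : ℝ) * y ^ D ≤ (Real.exp 1 * n * y / D) ^ D := by
  have h1 : (n.choose D : ℝ) ≤ n ^ D / D.factorial := Nat.choose_le_pow_div D n
  have hD' : (0 : ℝ) < D := by exact_mod_cast hD
  have h2 := Real.pow_div_factorial_le_exp (D : ℝ) hD'.le D
  have hf : (0 : ℝ) < D.factorial := by exact_mod_cast D.factorial_pos
  have h3 : (1 : ℝ) / D.factorial ≤ Real.exp 1 ^ D / D ^ D := by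
    rw [← Real.exp_nat_mul, mul_one, div_le_div_iff₀ hf (pow_pos hD' _), one_mul]
    rwa [div_le_iff₀ hf] at h2
  calc _ ≤ (n ^ D / D.factorial : ℝ) * y ^ D := mul_le_mul_of_nonneg_right h1 (pow_nonneg hy _)
    _ = (n * y) ^ D * (1 / D.factorial) := by rw [mul_pow]; ring
    _ ≤ (n * y) ^ D * (Real.exp 1 ^ D / D ^ D) := mul_le_mul_of_nonneg_left h3 (by positivity)
    _ = _ := by rw [div_pow, mul_assoc, mul_pow (Real.exp 1)]; ring

open scoped Classical in
theorem noise_hasLargeDegree_le {q : ℝ} (h0 : 0 ≤ q) (h1 : q ≤ 1) (D₁ D₂ : ℕ) :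
    noise q (pairs V) (fun x => if HasLargeDegree D₁ D₂ x then 1 else 0) ∅
      ≤ Fintype.card V * ((Fintype.card V).choose D₁ * q ^ D₁)
        + Fintype.card V ^ 2 * ((Fintype.card V).choose D₂ * (q ^ 2) ^ D₂) := by
  have hN := isRandomUnion_noise (pairs V) h0 h1
  set N := noise q (pairs V) with hNdef
  set I : Finset (Sym2 V) → Finset (Sym2 V) → ℝ := fun F x => if F ⊆ x then 1 else 0 with hI
  have hI0 : ∀ F x, 0 ≤ I F x := fun F x => by simp only [hI]; split_ifs <;> norm_num
  have hle : (fun x => if HasLargeDegree D₁ D₂ x then (1 : ℝ) else 0)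
      ≤ (∑ u : V, ∑ W ∈ (Finset.univ \ {u}).powersetCard D₁, I (starEdges u W))
        + ∑ u : V, ∑ v ∈ Finset.univ \ {u}, ∑ W ∈ (Finset.univ \ {u, v}).powersetCard D₂,
          I (starEdges u W ∪ starEdges v W) := by
    intro x
    simp only [Pi.add_apply, Finset.sum_apply]
    have hA : 0 ≤ ∑ u : V, ∑ W ∈ (Finset.univ \ {u}).powersetCard D₁, I (starEdges u W) x :=
      Finset.sum_nonneg fun u _ => Finset.sum_nonneg fun W _ => hI0 _ _
    have hB : 0 ≤ ∑ u : V, ∑ v ∈ Finset.univ \ {u},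
        ∑ W ∈ (Finset.univ \ {u, v}).powersetCard D₂, I (starEdges u W ∪ starEdges v W) x :=
      Finset.sum_nonneg fun u _ => Finset.sum_nonneg fun v _ => Finset.sum_nonneg fun W _ => hI0 _ _
    split_ifs with hx
    · rcases hx with ⟨u, W, hW, h⟩ | ⟨u, v, huv, W, hW, h⟩
      · have h2 : I (starEdges u W) x = 1 := if_pos h
        have h3 := Finset.single_le_sum (f := fun W => I (starEdges u W) x)
          (fun W _ => hI0 _ _) hW
        have h4 := Finset.single_le_sum
          (f := fun u => ∑ W ∈ (Finset.univ \ {u}).powersetCard D₁, I (starEdges u W) x)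
          (fun u _ => Finset.sum_nonneg fun W _ => hI0 _ _) (Finset.mem_univ u)
        linarith
      · have h2 : I (starEdges u W ∪ starEdges v W) x = 1 := if_pos h
        have h3 := Finset.single_le_sum (f := fun W => I (starEdges u W ∪ starEdges v W) x)
          (fun W _ => hI0 _ _) hW
        have h5 := Finset.single_le_sum
          (f := fun v => ∑ W ∈ (Finset.univ \ {u, v}).powersetCard D₂,
            I (starEdges u W ∪ starEdges v W) x)
          (fun u _ => Finset.sum_nonneg fun W _ => hI0 _ _)
          (show v ∈ Finset.univ \ {u} by simpa using huv.symm)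
        have h4 := Finset.single_le_sum
          (f := fun u => ∑ v ∈ Finset.univ \ {u}, ∑ W ∈ (Finset.univ \ {u, v}).powersetCard D₂,
            I (starEdges u W ∪ starEdges v W) x)
          (fun u _ => Finset.sum_nonneg fun v _ => Finset.sum_nonneg fun W _ => hI0 _ _)
          (Finset.mem_univ u)
        linarith
    · linarith
  refine (hN.mono hle ∅).trans ?_
  simp only [map_add, map_sum, Pi.add_apply, Finset.sum_apply]
  refine add_le_add ?_ ?_
  · calc _ ≤ ∑ u : V, ((Fintype.card V).choose D₁ * q ^ D₁ : ℝ) := by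
          refine Finset.sum_le_sum fun u _ => ?_
          calc _ = ∑ W ∈ (Finset.univ \ {u}).powersetCard D₁, q ^ D₁ := by
                refine Finset.sum_congr rfl fun W hW => ?_
                obtain ⟨hW, hc⟩ := Finset.mem_powersetCard.1 hW
                have hu : u ∉ W := fun h => by simpa using hW h
                rw [hNdef, hI, noise_superset (starEdges_subset_pairs hu), card_starEdges, hc]
            _ ≤ _ := by
                rw [Finset.sum_const, Finset.card_powersetCard, nsmul_eq_mul]
                refine mul_le_mul_of_nonneg_right ?_ (pow_nonneg h0 _)
                exact_mod_cast Nat.choose_le_choose _ (Finset.card_le_univ _)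
      _ = _ := by rw [Finset.sum_const, nsmul_eq_mul, Finset.card_univ]
  · calc _ ≤ ∑ u : V, ∑ v : V, ((Fintype.card V).choose D₂ * (q ^ 2) ^ D₂ : ℝ) := by
          refine Finset.sum_le_sum fun u _ => ?_
          refine le_trans (Finset.sum_le_sum fun v hv => ?_)
            (Finset.sum_le_sum_of_subset_of_nonneg (Finset.subset_univ _) fun v _ _ => by positivity)
          have huv : u ≠ v := by
            have := (Finset.mem_sdiff.1 hv).2
            exact fun h => this (by simp [h])
          calc _ = ∑ W ∈ (Finset.univ \ {u, v}).powersetCard D₂, (q ^ 2) ^ D₂ := by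
                refine Finset.sum_congr rfl fun W hW => ?_
                obtain ⟨hW, hc⟩ := Finset.mem_powersetCard.1 hW
                have hu : u ∉ W := fun h => by simpa using hW h
                have hv : v ∉ W := fun h => by simpa using hW h
                rw [hNdef, hI, noise_superset (Finset.union_subset (starEdges_subset_pairs hu)
                  (starEdges_subset_pairs hv)), card_starEdges_union huv hu, hc, pow_mul]
            _ ≤ _ := by
                rw [Finset.sum_const, Finset.card_powersetCard, nsmul_eq_mul]
                refine mul_le_mul_of_nonneg_right ?_ (by positivity)
                exact_mod_cast Nat.choose_le_choose _ (Finset.card_le_univ _)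
      _ = _ := by simp only [Finset.sum_const, nsmul_eq_mul, Finset.card_univ]; ring

end Codegrees

/-! ### Comparison of the two models -/

section Comparison

theorem noise_mono_param {E : Type*} [DecidableEq E] {q q' : ℝ} (h0 : 0 ≤ q) (hqq' : q ≤ q')
    (h1 : q' ≤ 1) (P : Finset E) {f : Finset E → ℝ} (hf : Monotone f) :
    noise q P f ≤ noise q' P f := by
  induction P using Finset.induction_on with
  | empty => intro g; simp [noise_apply]
  | insert e P he ih =>
    intro g
    rw [noise_insert q he, noise_insert q' he]
    have h2 := (isRandomUnion_noise P (h0.trans hqq') h1).monotone hf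
      (Finset.subset_union_left : g ⊆ g ∪ {e})
    have h3 := mul_le_mul_of_nonneg_left (ih g) (sub_nonneg.2 (hqq'.trans h1))
    have h4 := mul_le_mul_of_nonneg_left (ih (g ∪ {e})) h0
    nlinarith

theorem monotone_graphIndicator {V : Type*} [DecidableEq V] [Fintype V] {B : Set (SimpleGraph V)}
    (hB : ∀ G G' : SimpleGraph V, G ≤ G' → G ∈ B → G' ∈ B) : Monotone (graphIndicator B) := by
  intro F F' h
  unfold graphIndicator
  by_cases h1 : SimpleGraph.fromEdgeSet (F : Set (Sym2 V)) ∈ B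
  · have h2 := hB _ _ (SimpleGraph.fromEdgeSet_mono (Finset.coe_subset.2 h)) h1
    rw [if_pos h1, if_pos h2]
  · rw [if_neg h1]
    split_ifs <;> norm_num

theorem graphIndicator_nonneg {V : Type*} [DecidableEq V] [Fintype V] (B : Set (SimpleGraph V))
    (F : Finset (Sym2 V)) : 0 ≤ graphIndicator B F := by
  unfold graphIndicator; split_ifs <;> norm_num

theorem graphIndicator_le_one {V : Type*} [DecidableEq V] [Fintype V] (B : Set (SimpleGraph V))
    (F : Finset (Sym2 V)) : graphIndicator B F ≤ 1 := by
  unfold graphIndicator; split_ifs <;> norm_num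

variable {n : ℕ} {B : Set (SimpleGraph (Fin n))}

theorem probGnp_mono (hB : ∀ G G' : SimpleGraph (Fin n), G ≤ G' → G ∈ B → G' ∈ B) {q q' : ℝ}
    (h0 : 0 ≤ q) (hqq' : q ≤ q') (h1 : q' ≤ 1) : probGnp n q B ≤ probGnp n q' B := by
  rw [probGnp_eq_noise n h0 (hqq'.trans h1), probGnp_eq_noise n (h0.trans hqq') h1]
  exact noise_mono_param h0 hqq' h1 _ (monotone_graphIndicator hB) ∅

open scoped Classical in
/-- Upper comparison, for an increasing event `Bad` outside of which forcing cliques is cheap. -/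
theorem probGnmp_le_of_bad (hB : ∀ G G' : SimpleGraph (Fin n), G ≤ G' → G ∈ B → G' ∈ B)
    {m J : ℕ} {p r c ε : ℝ} (hp0 : 0 ≤ p) (hp1 : p ≤ 1) (h0 : 0 < r) (h1 : r ≤ 1) (hc : 0 ≤ c)
    (hε : 0 ≤ ε) (hsmall : (1 + c) * p ^ 2 * n ^ 2 ≤ 1)
    {Bad : Finset (Sym2 (Fin n)) → Prop} (hBad : ∀ x y, x ⊆ y → Bad x → Bad y)
    (H : ∀ x u v, u ≠ v → ¬ Bad x →
      ∑ j ∈ Finset.range (J + 1), (p * cherryCost r x u v) ^ j * r⁻¹ ^ j.choose 2 ≤ 1 + c)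
    {q : ℝ} (hq : q = 1 - Real.exp (-((1 + ε) * m * ((1 + c) * p ^ 2))) * (1 - r)) :
    probGnmp n m p B ≤ probGnp n q B
      + noise q (pairs (Fin n)) (fun x => if Bad x then 1 else 0) ∅
      + m * (n * p) ^ (J + 3) + ((1 + ε) / Real.exp ε) ^ m := by
  set s := (1 + c) * p ^ 2 with hs
  have hs0 : 0 ≤ s := by positivity
  have hexp : Real.exp (-((1 + ε) * m * s)) ≤ 1 := by
    rw [Real.exp_le_one_iff, neg_nonpos]; positivity
  have hexp0 := (Real.exp_pos (-((1 + ε) * m * s))).le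
  have hq0 : 0 ≤ q := by
    rw [hq, sub_nonneg]
    exact mul_le_one₀ hexp (sub_nonneg.2 h1) (sub_le_self _ h0.le)
  have hq1 : q ≤ 1 := by
    rw [hq]; exact sub_le_self _ (mul_nonneg hexp0 (sub_nonneg.2 h1))
  set P := pairs (Fin n) with hP
  have hPcard : s * P.card ≤ 1 := by
    refine le_trans (mul_le_mul_of_nonneg_left ?_ hs0) hsmall
    rw [hP, card_pairs, Fintype.card_fin]
    exact_mod_cast Nat.choose_le_pow n 2
  have hT := isRandomUnion_objectStep (V := Fin n) hp0 hp1
  have hT' := isRandomUnion_singleStep hs0 hPcard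
  have hN := isRandomUnion_noise P h0.le h1
  have hNq := isRandomUnion_noise P hq0 hq1
  set f : Finset (Sym2 (Fin n)) → ℝ := fun x => if Bad x then 1 else graphIndicator B x with hf
  have hgm := monotone_graphIndicator hB
  have hf0 : ∀ x, 0 ≤ f x := fun x => by
    simp only [hf]; split_ifs
    · norm_num
    · exact graphIndicator_nonneg B x
  have hf1 : ∀ x, f x ≤ 1 := fun x => by
    simp only [hf]; split_ifs
    · norm_num
    · exact graphIndicator_le_one B x
  have hfm : Monotone f := by
    intro x y hxy
    by_cases hx : Bad x
    · have hy := hBad x y hxy hx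
      simp [hf, hx, hy]
    · by_cases hy : Bad y
      · have : f y = 1 := if_pos hy
        rw [this]; exact hf1 x
      · simp only [hf, if_neg hx, if_neg hy]
        exact hgm hxy
  have hgf : graphIndicator B ≤ f := by
    intro x
    simp only [hf]
    split_ifs
    · exact graphIndicator_le_one B x
    · exact le_rfl
  have hpiv : ∀ x u v, u ≠ v → f (x ∪ {s(u, v)}) ≠ f x →
      ∑ j ∈ Finset.range (J + 1), (p * cherryCost r x u v) ^ j * r⁻¹ ^ j.choose 2 ≤ 1 + c := by
    intro x u v huv h
    refine H x u v huv fun hx => h ?_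
    have hy := hBad x (x ∪ {s(u, v)}) Finset.subset_union_left hx
    simp only [hf, if_pos hx, if_pos hy]
  have step := noise_objectStep_le hp0 hp1 h0 h1 J hfm hf0 hf1 hpiv
  rw [Fintype.card_fin] at step
  have rep := hT.replace hT' (hT.commute_singleStep s P) (hT.commute_noise r P)
    (hT'.commute_noise r P) f _ step m ∅
  have hmon := hT'.pow_apply_mono (hN.monotone hfm) ∅
  have poi := le_of_hasSum_poisson hmon
    (fun k => (hT'.pow k).nonneg_apply (hN.nonneg_apply hf0) ∅)
    (fun k => (hT'.pow k).apply_le_one (hN.apply_le_one hf1) ∅)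
    (μ := (1 + ε) * m) (t := (1 + ε)⁻¹) (by positivity) (by positivity)
    (inv_le_one_of_one_le₀ (by linarith)) m (hasSum_poisson_singleStep s _ r P f)
  rw [← hq] at poi
  have tail : (((1 + ε)⁻¹) ^ m)⁻¹ * Real.exp ((1 + ε) * m * ((1 + ε)⁻¹ - 1))
      = ((1 + ε) / Real.exp ε) ^ m := by
    have : (1 + ε) * m * ((1 + ε)⁻¹ - 1) = m * (-ε) := by
      have : (1 + ε) ≠ 0 := by positivity
      field_simp
      ring
    rw [this, Real.exp_nat_mul, inv_pow, inv_inv, ← mul_pow, Real.exp_neg, div_eq_mul_inv]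
  rw [tail] at poi
  have start : probGnmp n m p B ≤ (objectStep (Fin n) p ^ m) (noise r P f) ∅ := by
    rw [probGnmp_eq_objectStep n m hp0 hp1]
    exact (hT.pow m).mono (hgf.trans (hN.le_apply f hfm)) ∅
  have final : noise q P f ∅ ≤ probGnp n q B + noise q P (fun x => if Bad x then 1 else 0) ∅ := by
    rw [probGnp_eq_noise n hq0 hq1, ← Pi.add_apply, ← map_add]
    refine hNq.mono (fun x => ?_) ∅
    simp only [hf, Pi.add_apply]
    have := graphIndicator_nonneg B x
    split_ifs <;> linarith
  linarith

/-- Upper comparison: the cliques of more than two vertices hide in the noise, unless the binomial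
random graph has an unusually large degree or codegree. -/
theorem probGnmp_le_probGnp (hB : ∀ G G' : SimpleGraph (Fin n), G ≤ G' → G ∈ B → G' ∈ B)
    {m J K : ℕ} {p r c ε η κ : ℝ} (hp0 : 0 < p) (hp1 : p ≤ 1) (h0 : 0 < r) (h1 : r ≤ 1)
    (hc : 0 ≤ c) (hε : 0 ≤ ε) (hη : 0 < η) (hκ : 1 ≤ κ) (hsmall : (1 + c) * p ^ 2 * n ^ 2 ≤ 1)
    (hcost : ∑ j ∈ Finset.range (J + 1), (n * p + 3 * η) ^ j * r⁻¹ ^ j.choose 2 ≤ 1 + c)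
    {q : ℝ} (hq : q = 1 - Real.exp (-((1 + ε) * m * ((1 + c) * p ^ 2))) * (1 - r))
    (hqκ : q ≤ κ * r) (hK : K ≤ η * r ^ 2 / p)
    (hb : Real.exp 1 * κ ^ 2 * (n * p) / η ≤ 1) :
    probGnmp n m p B ≤ probGnp n q B + 2 * n ^ 2 * (Real.exp 1 * κ ^ 2 * (n * p) / η) ^ K
      + m * (n * p) ^ (J + 3) + ((1 + ε) / Real.exp ε) ^ m := by
  classical
  set b := Real.exp 1 * κ ^ 2 * (n * p) / η with hbdef
  have hb0 : 0 ≤ b := by positivity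
  have hexp : Real.exp (-((1 + ε) * m * ((1 + c) * p ^ 2))) ≤ 1 := by
    rw [Real.exp_le_one_iff, neg_nonpos]; positivity
  have hexp0 := (Real.exp_pos (-((1 + ε) * m * ((1 + c) * p ^ 2)))).le
  have hq0 : 0 ≤ q := by
    rw [hq, sub_nonneg]
    exact mul_le_one₀ hexp (sub_nonneg.2 h1) (sub_le_self _ h0.le)
  have hq1 : q ≤ 1 := by
    rw [hq]; exact sub_le_self _ (mul_nonneg hexp0 (sub_nonneg.2 h1))
  set D₁ := ⌈η * r / p⌉₊ with hD₁
  set D₂ := ⌈η * r ^ 2 / p⌉₊ with hD₂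
  have hD₁' : η * r / p ≤ D₁ := Nat.le_ceil _
  have hD₂' : η * r ^ 2 / p ≤ D₂ := Nat.le_ceil _
  have hD₁0 : 0 < D₁ := Nat.ceil_pos.2 (by positivity)
  have hD₂0 : 0 < D₂ := Nat.ceil_pos.2 (by positivity)
  have hKD₂ : K ≤ D₂ := by exact_mod_cast hK.trans hD₂'
  have hD₂D₁ : D₂ ≤ D₁ := by
    refine Nat.ceil_le_ceil ?_
    gcongr
    nlinarith
  have main := probGnmp_le_of_bad hB (m := m) (J := J) hp0.le hp1 h0 h1 hc hε hsmall
    (Bad := HasLargeDegree D₁ D₂) (fun x y hxy h => h.mono hxy) (fun x u v huv hx => ?_) hq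
  · have hbad := noise_hasLargeDegree_le (V := Fin n) hq0 hq1 D₁ D₂
    rw [Fintype.card_fin] at hbad
    have hD₁R : (0 : ℝ) < D₁ := by exact_mod_cast hD₁0
    have hD₂R : (0 : ℝ) < D₂ := by exact_mod_cast hD₂0
    have hκ2 : κ ≤ κ ^ 2 := by nlinarith
    have hb1 : Real.exp 1 * n * q / D₁ ≤ b := by
      have e1 : Real.exp 1 * n * q / D₁ ≤ Real.exp 1 * n * (κ ^ 2 * r) / (η * r / p) := by
        gcongr
        exact hqκ.trans (mul_le_mul_of_nonneg_right hκ2 h0.le)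
      refine e1.trans_eq ?_
      rw [hbdef]
      field_simp
    have hb2 : Real.exp 1 * n * q ^ 2 / D₂ ≤ b := by
      have e1 : Real.exp 1 * n * q ^ 2 / D₂ ≤ Real.exp 1 * n * (κ * r) ^ 2 / (η * r ^ 2 / p) := by
        gcongr
      refine e1.trans_eq ?_
      rw [hbdef]
      field_simp
    have t1 : (n.choose D₁ : ℝ) * q ^ D₁ ≤ b ^ K :=
      (choose_mul_pow_le n hD₁0 hq0).trans ((pow_le_pow_left₀ (by positivity) hb1 _).trans
        (pow_le_pow_of_le_one hb0 hb (hKD₂.trans hD₂D₁)))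
    have t2 : (n.choose D₂ : ℝ) * (q ^ 2) ^ D₂ ≤ b ^ K :=
      (choose_mul_pow_le n hD₂0 (sq_nonneg q)).trans ((pow_le_pow_left₀ (by positivity) hb2 _).trans
        (pow_le_pow_of_le_one hb0 hb hKD₂))
    have hbK : 0 ≤ b ^ K := pow_nonneg hb0 _
    have hn : (n : ℝ) ≤ n ^ 2 := by exact_mod_cast Nat.le_self_pow two_ne_zero n
    have : (n : ℝ) * (n.choose D₁ * q ^ D₁) + n ^ 2 * (n.choose D₂ * (q ^ 2) ^ D₂)
        ≤ 2 * n ^ 2 * b ^ K := by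
      have a1 : (n : ℝ) * (n.choose D₁ * q ^ D₁) ≤ n ^ 2 * b ^ K := by gcongr
      have a2 : (n : ℝ) ^ 2 * (n.choose D₂ * (q ^ 2) ^ D₂) ≤ n ^ 2 * b ^ K := by gcongr
      linarith
    linarith
  · refine le_trans (Finset.sum_le_sum fun j _ => ?_) hcost
    have hr : 0 ≤ r⁻¹ := (inv_pos.2 h0).le
    have hz0 : 0 ≤ cherryCost r x u v := Finset.sum_nonneg fun w _ =>
      mul_nonneg (zero_le_one.trans (one_le_energyCost h0 h1 x _))
        (zero_le_one.trans (one_le_energyCost h0 h1 x _))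
    have hz := cherryCost_le h0 h1 hx huv (d₁ := η * r / p) (d₂ := η * r ^ 2 / p)
      (fun k hk => (Nat.lt_ceil.1 hk).le) (fun k hk => (Nat.lt_ceil.1 hk).le)
    rw [Fintype.card_fin] at hz
    have hpz : p * cherryCost r x u v ≤ n * p + 3 * η := by
      refine (mul_le_mul_of_nonneg_left hz hp0.le).trans_eq ?_
      field_simp
      ring
    exact mul_le_mul_of_nonneg_right (pow_le_pow_left₀ (mul_nonneg hp0.le hz0) hpz _)
      (pow_nonneg hr _)

theorem cliqueEdges_toFinset {V : Type*} [DecidableEq V] {e : Sym2 V} (he : ¬ e.IsDiag) :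
    cliqueEdges e.toFinset = {e} := by
  refine (Finset.eq_of_subset_of_card_le (Finset.singleton_subset_iff.2 ?_) ?_).symm
  · exact mem_cliqueEdges.2 ⟨fun v hv => Sym2.mem_toFinset.2 hv, he⟩
  · rw [card_cliqueEdges, Sym2.card_toFinset_of_not_isDiag e he]
    simp

/-- An object held by exactly two vertices adds a single edge. -/
theorem singleStep_le_objectStep {V : Type*} [DecidableEq V] [Fintype V] {p : ℝ} (hp0 : 0 ≤ p)
    (hp1 : p ≤ 1) {f : Finset (Sym2 V) → ℝ} (hf : Monotone f) :
    singleStep (p ^ 2 * (1 - p) ^ (Fintype.card V - 2)) (pairs V) f ≤ objectStep V p f := by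
  intro g
  have e1 : objectStep V p f g - f g = ∑ S : Finset V,
      p ^ S.card * (1 - p) ^ (Fintype.card V - S.card) * (f (g ∪ cliqueEdges S) - f g) := by
    rw [← Pi.sub_apply, objectStep_apply_sub]
    simp
  have hinj : Set.InjOn Sym2.toFinset (pairs V : Set (Sym2 V)) := by
    intro e he e' he' h
    have h1 := cliqueEdges_toFinset (mem_pairs.1 he)
    rw [h, cliqueEdges_toFinset (mem_pairs.1 he')] at h1
    exact (Finset.singleton_injective h1).symm
  have e2 : ∑ S ∈ (pairs V).image Sym2.toFinset,
      p ^ S.card * (1 - p) ^ (Fintype.card V - S.card) * (f (g ∪ cliqueEdges S) - f g)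
      ≤ ∑ S : Finset V,
      p ^ S.card * (1 - p) ^ (Fintype.card V - S.card) * (f (g ∪ cliqueEdges S) - f g) :=
    Finset.sum_le_sum_of_subset_of_nonneg (Finset.subset_univ _) fun S _ _ =>
      mul_nonneg (mul_nonneg (pow_nonneg hp0 _) (pow_nonneg (sub_nonneg.2 hp1) _))
        (sub_nonneg.2 (hf Finset.subset_union_left))
  rw [Finset.sum_image hinj] at e2
  have e3 : ∑ e ∈ pairs V, p ^ e.toFinset.card * (1 - p) ^ (Fintype.card V - e.toFinset.card)
      * (f (g ∪ cliqueEdges e.toFinset) - f g)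
      = p ^ 2 * (1 - p) ^ (Fintype.card V - 2) * ∑ e ∈ pairs V, (f (g ∪ {e}) - f g) := by
    rw [Finset.mul_sum]
    refine Finset.sum_congr rfl fun e he => ?_
    have := mem_pairs.1 he
    rw [cliqueEdges_toFinset this, Sym2.card_toFinset_of_not_isDiag e this]
  rw [e3, ← e1] at e2
  rw [singleStep_apply]
  linarith

/-- Lower comparison: single-edge objects suffice, and a Poisson number of them with mean
`(1 - ε) * m` rarely exceeds `m`. -/
theorem probGnp_le_probGnmp (hB : ∀ G G' : SimpleGraph (Fin n), G ≤ G' → G ∈ B → G' ∈ B)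
    {m : ℕ} {p ε : ℝ} (hp0 : 0 ≤ p) (hp1 : p ≤ 1) (hε0 : 0 ≤ ε) (hε1 : ε < 1) :
    probGnp n (1 - Real.exp (-((1 - ε) * m * (p ^ 2 * (1 - p) ^ (n - 2))))) B
      ≤ probGnmp n m p B + ((1 - ε) * Real.exp ε) ^ m := by
  set s := p ^ 2 * (1 - p) ^ (n - 2) with hs
  have hs0 : 0 ≤ s := mul_nonneg (sq_nonneg p) (pow_nonneg (sub_nonneg.2 hp1) _)
  have hε : 0 < 1 - ε := sub_pos.2 hε1
  set P := pairs (Fin n) with hP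
  have hT := isRandomUnion_objectStep (V := Fin n) hp0 hp1
  have hPcard : s * P.card ≤ 1 := by
    rw [hP, card_pairs, Fintype.card_fin]
    have h1 := sum_objectStep_weight (V := Fin n) p
    rw [Fintype.card_fin] at h1
    have h2 : ∑ S ∈ (Finset.univ : Finset (Fin n)).powersetCard 2,
        p ^ S.card * (1 - p) ^ (n - S.card) = s * (n.choose 2 : ℕ) := by
      have h3 : ∀ S ∈ (Finset.univ : Finset (Fin n)).powersetCard 2,
          p ^ S.card * (1 - p) ^ (n - S.card) = s := fun S hS => by
        rw [(Finset.mem_powersetCard.1 hS).2]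
      rw [Finset.sum_congr rfl h3, Finset.sum_const, Finset.card_powersetCard, Finset.card_univ,
        Fintype.card_fin, nsmul_eq_mul, mul_comm]
    rw [← h2]
    refine le_trans (Finset.sum_le_sum_of_subset_of_nonneg (Finset.subset_univ _) fun S _ _ => ?_)
      h1.le
    exact mul_nonneg (pow_nonneg hp0 _) (pow_nonneg (sub_nonneg.2 hp1) _)
  have hT' := isRandomUnion_singleStep hs0 hPcard
  have hgm := monotone_graphIndicator hB
  have h1 : ∀ f, Monotone f → singleStep s P f ≤ objectStep (Fin n) p f := by
    intro f hf
    have := singleStep_le_objectStep (V := Fin n) hp0 hp1 hf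
    rwa [Fintype.card_fin] at this
  have hmon := hT'.pow_apply_mono hgm ∅
  have hnoise : noise 0 P (graphIndicator B) = graphIndicator B := by
    ext g
    rw [noise_apply, Finset.sum_eq_single ∅]
    · simp
    · intro F _ hF
      have : F.card ≠ 0 := fun h => hF (Finset.card_eq_zero.1 h)
      simp [this]
    · simp
  have hsum := hasSum_poisson_singleStep s ((1 - ε) * m) 0 P (graphIndicator B)
  rw [hnoise] at hsum
  have poi := hasSum_poisson_le hmon
    (fun k => (hT'.pow k).nonneg_apply (graphIndicator_nonneg B) ∅)
    (fun k => (hT'.pow k).apply_le_one (graphIndicator_le_one B) ∅)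
    (μ := (1 - ε) * m) (t := (1 - ε)⁻¹) (by positivity)
    ((one_le_inv₀ hε).2 (by linarith)) m hsum
  have tail : (((1 - ε)⁻¹) ^ m)⁻¹ * Real.exp ((1 - ε) * m * ((1 - ε)⁻¹ - 1))
      = ((1 - ε) * Real.exp ε) ^ m := by
    have : (1 - ε) * m * ((1 - ε)⁻¹ - 1) = m * ε := by
      field_simp
      ring
    rw [this, Real.exp_nat_mul, inv_pow, inv_inv, ← mul_pow]
  rw [tail, sub_zero, mul_one] at poi
  have hexp : Real.exp (-((1 - ε) * m * s)) ≤ 1 := by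
    rw [Real.exp_le_one_iff, neg_nonpos]; positivity
  rw [probGnp_eq_noise n (sub_nonneg.2 hexp) (sub_le_self _ (Real.exp_pos _).le),
    probGnmp_eq_objectStep n m hp0 hp1]
  have := hT'.pow_le_pow hT hgm h1 m ∅
  linarith

end Comparison

/-! ### The upper comparison for large `n` -/

section Arithmetic

variable {n m p δ C : ℝ}

theorem sq_mul_pow_le_of_sparse (hn : 0 < n) (hm : n ^ 3 / 2 ≤ m) (hp : 0 < p)
    (hC : m * p ^ 2 ≤ C) (hn1 : 1 ≤ n) :
    n ^ 2 * (n * p / (m * p ^ 2) ^ 0) ^ 12 ≤ (2 * C) ^ 6 / n := by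
  have h1 : (n * p) ^ 2 * n ≤ 2 * C := by nlinarith [sq_nonneg p]
  have h2 := pow_le_pow_left₀ (by positivity) h1 6
  rw [pow_zero, div_one, le_div_iff₀ hn]
  refine le_trans ?_ h2
  have h3 : n ^ 3 ≤ n ^ 6 := pow_le_pow_right₀ hn1 (by norm_num)
  calc _ = n ^ 3 * (n * p) ^ 12 := by ring
    _ ≤ n ^ 6 * (n * p) ^ 12 := by gcongr
    _ = _ := by ring

theorem sq_mul_pow_le_of_four (hn : 0 < n) (hm : n ^ 3 / 2 ≤ m) (hp : 0 < p) (hδ : 0 < δ)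
    (h : δ ≤ m * (n * p) ^ 4) :
    n ^ 2 * (n * p / (m * p ^ 2) ^ 1) ^ 12 ≤ 2 ^ 9 / δ ^ 3 / n := by
  have hm0 : 0 < m := lt_of_lt_of_le (by positivity) hm
  have h1 := pow_le_pow_left₀ hδ.le h 3
  have h2 := pow_le_pow_left₀ (by positivity) hm 9
  have e : n ^ 2 * (n * p / (m * p ^ 2) ^ 1) ^ 12 = n ^ 14 / (m ^ 12 * p ^ 12) := by
    field_simp
  rw [e, div_div, div_le_div_iff₀ (by positivity) (by positivity)]
  calc n ^ 14 * (δ ^ 3 * n) ≤ n ^ 14 * ((m * (n * p) ^ 4) ^ 3 * n) := by gcongr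
    _ = 2 ^ 9 * (m ^ 3 * p ^ 12 * (n ^ 3 / 2) ^ 9) := by ring
    _ ≤ 2 ^ 9 * (m ^ 3 * p ^ 12 * m ^ 9) := by gcongr
    _ = _ := by ring

theorem pow_div_ge_of_four (hn : 0 < n) (hm : n ^ 3 / 2 ≤ m) (hp : 0 < p) (hδ : 0 < δ)
    (h : δ ≤ m * (n * p) ^ 4) : n * (δ ^ 5 / 2 ^ 7) ≤ ((m * p ^ 2) ^ 3 / p) ^ 4 := by
  have hm0 : 0 < m := lt_of_lt_of_le (by positivity) hm
  have h1 := pow_le_pow_left₀ hδ.le h 5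
  have h2 := pow_le_pow_left₀ (by positivity) hm 7
  have e : ((m * p ^ 2) ^ 3 / p) ^ 4 = m ^ 12 * p ^ 20 := by field_simp
  rw [e]
  have : n ^ 20 * (n * (δ ^ 5 / 2 ^ 7)) ≤ n ^ 20 * (m ^ 12 * p ^ 20) := by
    calc n ^ 20 * (n * (δ ^ 5 / 2 ^ 7)) = (n ^ 3 / 2) ^ 7 * δ ^ 5 := by ring
      _ ≤ m ^ 7 * (m * (n * p) ^ 4) ^ 5 := by gcongr
      _ = _ := by ring
  exact le_of_mul_le_mul_left this (by positivity)

theorem sq_mul_pow_le_of_five (hn : 0 < n) (hm : n ^ 3 / 2 ≤ m) (hp : 0 < p) (hδ : 0 < δ)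
    (h : δ ≤ m * (n * p) ^ 5) :
    n ^ 2 * (n * p / (m * p ^ 2) ^ 2) ^ 15 ≤ 2 ^ 21 / δ ^ 9 / n := by
  have hm0 : 0 < m := lt_of_lt_of_le (by positivity) hm
  have h1 := pow_le_pow_left₀ hδ.le h 9
  have h2 := pow_le_pow_left₀ (by positivity) hm 21
  have e : n ^ 2 * (n * p / (m * p ^ 2) ^ 2) ^ 15 = n ^ 17 / (m ^ 30 * p ^ 45) := by
    field_simp
  rw [e, div_div, div_le_div_iff₀ (by positivity) (by positivity)]
  calc n ^ 17 * (δ ^ 9 * n) ≤ n ^ 17 * ((m * (n * p) ^ 5) ^ 9 * n) := by gcongr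
    _ = 2 ^ 21 * (m ^ 9 * p ^ 45 * (n ^ 3 / 2) ^ 21) := by ring
    _ ≤ 2 ^ 21 * (m ^ 9 * p ^ 45 * m ^ 21) := by gcongr
    _ = _ := by ring

theorem pow_div_ge_of_five (hn : 1 ≤ n) (hm : n ^ 3 / 2 ≤ m) (hp : 0 < p) (hδ : 0 < δ)
    (h : δ ≤ m * (n * p) ^ 5) : n * (δ ^ 7 / 2 ^ 13) ≤ ((m * p ^ 2) ^ 4 / p) ^ 5 := by
  have hn0 : 0 < n := zero_lt_one.trans_le hn
  have hm0 : 0 < m := lt_of_lt_of_le (by positivity) hm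
  have h1 := pow_le_pow_left₀ hδ.le h 7
  have h2 := pow_le_pow_left₀ (by positivity) hm 13
  have e : ((m * p ^ 2) ^ 4 / p) ^ 5 = m ^ 20 * p ^ 35 := by field_simp
  rw [e]
  have h3 : n ≤ n ^ 4 := le_self_pow₀ hn (by norm_num)
  have : n ^ 35 * (n * (δ ^ 7 / 2 ^ 13)) ≤ n ^ 35 * (m ^ 20 * p ^ 35) := by
    calc n ^ 35 * (n * (δ ^ 7 / 2 ^ 13)) ≤ n ^ 35 * (n ^ 4 * (δ ^ 7 / 2 ^ 13)) := by gcongr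
      _ = (n ^ 3 / 2) ^ 13 * δ ^ 7 := by ring
      _ ≤ m ^ 13 * (m * (n * p) ^ 5) ^ 7 := by gcongr
      _ = _ := by ring
  exact le_of_mul_le_mul_left this (by positivity)

theorem sq_mul_seven_le (hn : 0 < n) (hm : n ^ 3 / 2 ≤ m) (hp : 0 < p) (hC : m * p ^ 2 ≤ C) :
    (m * (n * p) ^ 7) ^ 2 ≤ 2 ^ 5 * C ^ 7 / n := by
  have hm0 : 0 < m := lt_of_lt_of_le (by positivity) hm
  have h1 := pow_le_pow_left₀ (by positivity) hC 7
  have h2 := pow_le_pow_left₀ (by positivity) hm 5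
  rw [le_div_iff₀ hn]
  calc (m * (n * p) ^ 7) ^ 2 * n = 2 ^ 5 * ((n ^ 3 / 2) ^ 5 * (m ^ 2 * p ^ 14)) := by ring
    _ ≤ 2 ^ 5 * (m ^ 5 * (m ^ 2 * p ^ 14)) := by gcongr
    _ = 2 ^ 5 * (m * p ^ 2) ^ 7 := by ring
    _ ≤ _ := by gcongr

end Arithmetic

section Upper

/-- With `η = θ / 16 * r ^ β`, forcing cliques on up to `J + 2` vertices costs only a factor
`1 + θ`. The admissible `(J, β)` satisfy `j * (j - 1) / 2 ≤ β * j` for `j ≤ J`. -/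
theorem clique_cost_le {J β : ℕ} (hJ : (J = 1 ∧ β = 0) ∨ (J = 2 ∧ β = 1) ∨ (J = 4 ∧ β = 2))
    {r θ x : ℝ} (h0 : 0 < r) (h1 : r ≤ 1) (hθ0 : 0 < θ) (hθ1 : θ ≤ 1) (hx0 : 0 ≤ x)
    (hx : x ≤ 4 * (θ / 16 * r ^ β)) :
    ∑ j ∈ Finset.range (J + 1), x ^ j * r⁻¹ ^ j.choose 2 ≤ 1 + θ := by
  have key : ∀ j e : ℕ, 0 < j → e ≤ β * j → x ^ j * r⁻¹ ^ e ≤ θ / 4 := by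
    intro j e hj he
    have hx' : x ≤ θ / 4 * r ^ β := by linarith
    calc x ^ j * r⁻¹ ^ e ≤ (θ / 4 * r ^ β) ^ j * r⁻¹ ^ e := by gcongr
      _ = (θ / 4) ^ j * (r ^ (β * j) * r⁻¹ ^ e) := by rw [mul_pow, ← pow_mul]; ring
      _ ≤ (θ / 4) ^ j * 1 := by
          refine mul_le_mul_of_nonneg_left ?_ (by positivity)
          rw [inv_pow, mul_inv_le_iff₀ (pow_pos h0 _), one_mul]
          exact pow_le_pow_of_le_one h0.le h1 he
      _ ≤ θ / 4 := by
          rw [mul_one]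
          exact pow_le_of_le_one (by positivity) (by linarith) hj.ne'
  rcases hJ with ⟨rfl, rfl⟩ | ⟨rfl, rfl⟩ | ⟨rfl, rfl⟩
  · have k1 := key 1 0 (by norm_num) (by norm_num)
    simp only [Finset.sum_range_succ, Finset.sum_range_zero, Nat.choose, pow_zero]
    norm_num at k1 ⊢
    linarith
  · have k1 := key 1 0 (by norm_num) (by norm_num)
    have k2 := key 2 1 (by norm_num) (by norm_num)
    simp only [Finset.sum_range_succ, Finset.sum_range_zero, Nat.choose, pow_zero]
    norm_num at k1 k2 ⊢
    linarith
  · have k1 := key 1 0 (by norm_num) (by norm_num)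
    have k2 := key 2 1 (by norm_num) (by norm_num)
    have k3 := key 3 3 (by norm_num) (by norm_num)
    have k4 := key 4 6 (by norm_num) (by norm_num)
    simp only [Finset.sum_range_succ, Finset.sum_range_zero, Nat.choose, pow_zero]
    norm_num at k1 k2 k3 k4 ⊢
    linarith

variable {n m : ℕ} {B : Set (SimpleGraph (Fin n))}

/-- The intensity `θ * m * p ^ 2` of the noise leaves room below `4 * θ * m * p ^ 2`. -/
theorem noise_intensity_le {θ lam : ℝ} (hθ0 : 0 < θ) (hθ1 : θ ≤ 1) (hl : 0 ≤ lam) :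
    1 - Real.exp (-((1 + θ) * ((1 + θ) * lam))) * (1 - (1 - Real.exp (-(θ * lam))))
      ≤ 1 - Real.exp (-((1 + 4 * θ) * lam)) := by
  rw [sub_sub_cancel, ← Real.exp_add]
  refine sub_le_sub_left (Real.exp_le_exp.2 ?_) 1
  nlinarith [mul_nonneg (mul_nonneg hθ0.le (sub_nonneg.2 hθ1)) hl]

theorem div_le_one_sub_exp {θ lam C : ℝ} (hθ0 : 0 < θ) (hl : 0 ≤ lam) (hC : lam ≤ C) :
    θ / (1 + θ * C) * lam ≤ 1 - Real.exp (-(θ * lam)) := by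
  have h1 : 0 ≤ θ * lam := by positivity
  have h2 : Real.exp (-(θ * lam)) ≤ (1 + θ * lam)⁻¹ := by
    rw [Real.exp_neg]
    refine inv_anti₀ (by positivity) ?_
    linarith [Real.add_one_le_exp (θ * lam)]
  have h3 : 1 - (1 + θ * lam)⁻¹ = θ * lam / (1 + θ * lam) := by
    have : (1 + θ * lam) ≠ 0 := by positivity
    field_simp
    ring
  have h4 : θ / (1 + θ * C) * lam ≤ θ * lam / (1 + θ * lam) := by
    rw [div_mul_eq_mul_div]
    gcongr
  linarith

/-- Upper comparison when no object is assigned to three vertices. -/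
theorem probGnmp_le_of_no_triangle
    (hB : ∀ G G' : SimpleGraph (Fin n), G ≤ G' → G ∈ B → G' ∈ B) {p θ : ℝ} (hp0 : 0 < p)
    (hp1 : p ≤ 1) (hm : 0 < m) (hθ0 : 0 < θ) (hθ1 : θ ≤ 1) (hsmall : 2 * p ^ 2 * n ^ 2 ≤ 1) :
    probGnmp n m p B ≤ probGnp n (1 - Real.exp (-((1 + 4 * θ) * (m * p ^ 2)))) B
      + m * (n * p) ^ 3 + ((1 + θ) / Real.exp θ) ^ m := by
  classical
  set lam := (m : ℝ) * p ^ 2 with hlam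
  have hm' : (0 : ℝ) < m := by exact_mod_cast hm
  have hl0 : 0 < lam := by positivity
  set r := 1 - Real.exp (-(θ * lam)) with hr
  have hr1 : r ≤ 1 := sub_le_self _ (Real.exp_pos _).le
  have hr0 : 0 < r := by
    rw [hr, sub_pos, Real.exp_lt_one_iff]
    have : 0 < θ * lam := by positivity
    linarith
  have hs : (1 + θ) * p ^ 2 * n ^ 2 ≤ 1 := by
    refine le_trans ?_ hsmall
    gcongr
    linarith
  have main := probGnmp_le_of_bad hB (m := m) (J := 0) hp0.le hp1 hr0 hr1 hθ0.le hθ0.le hs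
    (Bad := fun _ => False) (fun _ _ _ h => h) (fun x u v _ _ => by simp [hθ0.le]) rfl
  simp only [if_false] at main
  rw [show (fun _ : Finset (Sym2 (Fin n)) => (0 : ℝ)) = 0 from rfl, map_zero, Pi.zero_apply]
    at main
  have e1 : (1 + θ) * m * ((1 + θ) * p ^ 2) = (1 + θ) * ((1 + θ) * lam) := by rw [hlam]; ring
  rw [e1] at main
  have h2 := noise_intensity_le hθ0 hθ1 hl0.le
  have h3 : 0 ≤ 1 - Real.exp (-((1 + θ) * ((1 + θ) * lam))) * (1 - r) := by
    rw [sub_nonneg]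
    refine mul_le_one₀ ?_ (sub_nonneg.2 hr1) (sub_le_self _ hr0.le)
    rw [Real.exp_le_one_iff, neg_nonpos]; positivity
  have h4 := probGnp_mono hB h3 h2 (sub_le_self _ (Real.exp_pos _).le)
  linarith

/-- Upper comparison when the noise hides the cliques on three to `J + 2` vertices. -/
theorem probGnmp_le_of_hidden
    (hB : ∀ G G' : SimpleGraph (Fin n), G ≤ G' → G ∈ B → G' ∈ B) {p θ C γ A : ℝ} (hp0 : 0 < p)
    (hp1 : p ≤ 1) (hm : 0 < m) (hθ0 : 0 < θ) (hθ1 : θ ≤ 1 / 4) (hsmall : 2 * p ^ 2 * n ^ 2 ≤ 1)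
    (hC : m * p ^ 2 ≤ C) (hγ : γ = θ / (1 + θ * C))
    (hA : A = Real.exp 1 * (2 / γ) ^ 2 / (θ / 16 * γ ^ 2))
    {J β K : ℕ} (hJ : (J = 1 ∧ β = 0) ∨ (J = 2 ∧ β = 1) ∨ (J = 4 ∧ β = 2))
    (hb : A * (n * p / (m * p ^ 2) ^ β) ≤ 1)
    (hK : K ≤ θ / 16 * γ ^ 4 * ((m * p ^ 2) ^ (2 + β) / p)) :
    probGnmp n m p B ≤ probGnp n (1 - Real.exp (-((1 + 4 * θ) * (m * p ^ 2)))) B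
      + 2 * n ^ 2 * (A * (n * p / (m * p ^ 2) ^ β)) ^ K
      + m * (n * p) ^ (J + 3) + ((1 + θ) / Real.exp θ) ^ m := by
  set lam := (m : ℝ) * p ^ 2 with hlam
  have hm' : (0 : ℝ) < m := by exact_mod_cast hm
  have hl0 : 0 < lam := by positivity
  have hC0 : 0 < C := hl0.trans_le hC
  have hγ0 : 0 < γ := by rw [hγ]; positivity
  have hγ1 : γ ≤ 1 := by
    rw [hγ, div_le_one (by positivity)]
    nlinarith
  have hβ2 : β ≤ 2 := by omega
  set r := 1 - Real.exp (-(θ * lam)) with hr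
  have hr1 : r ≤ 1 := sub_le_self _ (Real.exp_pos _).le
  have hrl : γ * lam ≤ r := by rw [hγ]; exact div_le_one_sub_exp hθ0 hl0.le hC
  have hr0 : 0 < r := lt_of_lt_of_le (by positivity) hrl
  have hs : (1 + θ) * p ^ 2 * n ^ 2 ≤ 1 := by
    refine le_trans ?_ hsmall
    gcongr
    linarith
  set η := θ / 16 * r ^ β with hη
  have hη0 : 0 < η := by positivity
  have hκ1 : 1 ≤ 2 / γ := by rw [le_div_iff₀ hγ0]; linarith
  have hbase : Real.exp 1 * (2 / γ) ^ 2 * (n * p) / η ≤ A * (n * p / lam ^ β) := by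
    have h1 : θ / 16 * (γ ^ 2 * lam ^ β) ≤ η := by
      rw [hη]
      refine mul_le_mul_of_nonneg_left ?_ (by positivity)
      calc γ ^ 2 * lam ^ β ≤ γ ^ β * lam ^ β := by
            refine mul_le_mul_of_nonneg_right ?_ (by positivity)
            exact pow_le_pow_of_le_one hγ0.le hγ1 hβ2
        _ = (γ * lam) ^ β := (mul_pow _ _ _).symm
        _ ≤ r ^ β := pow_le_pow_left₀ (by positivity) hrl _
    calc _ ≤ Real.exp 1 * (2 / γ) ^ 2 * (n * p) / (θ / 16 * (γ ^ 2 * lam ^ β)) := by gcongr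
      _ = _ := by rw [hA]; field_simp
  have hb1 := hbase.trans hb
  have hnp : n * p ≤ η := by
    rw [div_le_one hη0] at hb1
    refine le_trans ?_ hb1
    refine le_mul_of_one_le_left (by positivity) ?_
    have := Real.add_one_le_exp (1 : ℝ)
    nlinarith
  have hcost := clique_cost_le hJ hr0 hr1 hθ0 (by linarith) (x := n * p + 3 * η) (by positivity)
    (by linarith)
  have e1 : (1 + θ) * m * ((1 + θ) * p ^ 2) = (1 + θ) * ((1 + θ) * lam) := by rw [hlam]; ring
  have h2 := noise_intensity_le hθ0 (by linarith) hl0.le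
  have hq : 1 - Real.exp (-((1 + 4 * θ) * lam)) ≤ 2 / γ * r := by
    have h5 : 1 - Real.exp (-((1 + 4 * θ) * lam)) ≤ (1 + 4 * θ) * lam := by
      linarith [Real.add_one_le_exp (-((1 + 4 * θ) * lam))]
    have h6 : 2 * lam ≤ 2 / γ * r := by
      rw [div_mul_eq_mul_div, le_div_iff₀ hγ0]; linarith
    nlinarith
  have hK' : (K : ℝ) ≤ η * r ^ 2 / p := by
    refine hK.trans ?_
    have h7 : γ ^ 4 * lam ^ (2 + β) ≤ r ^ (2 + β) := by
      calc γ ^ 4 * lam ^ (2 + β) ≤ γ ^ (2 + β) * lam ^ (2 + β) := by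
            refine mul_le_mul_of_nonneg_right ?_ (by positivity)
            exact pow_le_pow_of_le_one hγ0.le hγ1 (by omega)
        _ = (γ * lam) ^ (2 + β) := (mul_pow _ _ _).symm
        _ ≤ _ := pow_le_pow_left₀ (by positivity) hrl _
    have e2 : η * r ^ 2 / p = θ / 16 * (r ^ (2 + β) / p) := by rw [hη, pow_add]; ring
    rw [e2, mul_assoc, ← mul_div_assoc]
    gcongr
  have main := probGnmp_le_probGnp hB (m := m) hp0 hp1 hr0 hr1 hθ0.le hθ0.le hη0 hκ1 hs hcost rfl
    (by rw [e1]; exact h2.trans hq) hK' hb1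
  rw [e1] at main
  have h3 : 0 ≤ 1 - Real.exp (-((1 + θ) * ((1 + θ) * lam))) * (1 - r) := by
    rw [sub_nonneg]
    refine mul_le_one₀ ?_ (sub_nonneg.2 hr1) (sub_le_self _ hr0.le)
    rw [Real.exp_le_one_iff, neg_nonpos]; positivity
  have h4 := probGnp_mono hB h3 h2 (sub_le_self _ (Real.exp_pos _).le)
  have h8 : (Real.exp 1 * (2 / γ) ^ 2 * (n * p) / η) ^ K ≤ (A * (n * p / lam ^ β)) ^ K :=
    pow_le_pow_left₀ (by positivity) hbase _
  have h9 := mul_le_mul_of_nonneg_left h8 (show (0 : ℝ) ≤ 2 * n ^ 2 by positivity)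
  linarith

theorem probGnmp_zero (n m : ℕ) (B : Set (SimpleGraph (Fin n))) :
    probGnmp n m 0 B = probGnp n 0 B := by
  have h1 : objectStep (Fin n) 0 = 1 := by
    rw [objectStep, Finset.sum_eq_single ∅]
    · ext f g; simp [cliqueEdges]
    · intro S _ hS
      have : S.card ≠ 0 := fun h => hS (Finset.card_eq_zero.1 h)
      simp [this]
    · simp
  rw [probGnmp_eq_objectStep n m le_rfl zero_le_one, probGnp_eq_noise n le_rfl zero_le_one, h1,
    one_pow, Module.End.one_apply, noise_apply, Finset.sum_eq_single ∅]
  · simp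
  · intro F _ hF
    have : F.card ≠ 0 := fun h => hF (Finset.card_eq_zero.1 h)
    simp [this]
  · simp

theorem eventually_div_le (c : ℝ) {d : ℝ} (hd : 0 < d) : ∀ᶠ n : ℕ in atTop, c / n ≤ d :=
  (tendsto_const_div_atTop_nhds_zero_nat c).eventually_le_const hd

theorem error_le_of_sq_mul_pow_le {x A y c d : ℝ} {K : ℕ} (hx : 1 ≤ x) (hA : 0 ≤ A) (hy : 0 ≤ y)
    (hK : K ≠ 0) (h : x ^ 2 * y ^ K ≤ c / x) (hc : 2 * A ^ K * c / x ≤ min d 1) :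
    2 * x ^ 2 * (A * y) ^ K ≤ d ∧ A * y ≤ 1 := by
  have h1 : 2 * x ^ 2 * (A * y) ^ K ≤ min d 1 := by
    calc _ = 2 * A ^ K * (x ^ 2 * y ^ K) := by ring
      _ ≤ 2 * A ^ K * (c / x) := by gcongr
      _ = 2 * A ^ K * c / x := by ring
      _ ≤ _ := hc
  refine ⟨h1.trans (min_le_left _ _), ?_⟩
  have h2 : (A * y) ^ K ≤ 1 := by
    refine le_trans ?_ (h1.trans (min_le_right _ _))
    refine le_mul_of_one_le_left (by positivity) ?_
    nlinarith
  exact (pow_le_one_iff_of_nonneg (by positivity) hK).1 h2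

/-- The upper comparison: if triangles are either absent (`m (n p) ^ 3` is small) or much rarer than
in the binomial random graph (`m ^ 2 p ^ 3` is large), then increasing properties are at most a
little more likely in the intersection graph than in a slightly denser binomial graph. -/
theorem eventually_probGnmp_le {ε δ C : ℝ} (hε0 : 0 < ε) (hε1 : ε ≤ 1) (hδ : 0 < δ) (hC : 0 < C) :
    ∃ K η : ℝ, 0 < K ∧ 0 < η ∧ ∀ᶠ n : ℕ in atTop, ∀ m : ℕ, (n : ℝ) ^ 3 / 2 ≤ m →
      ∀ p : ℝ, 0 ≤ p → p ≤ 1 → m * p ^ 2 ≤ C →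
      (m * (n * p) ^ 3 ≤ η ∨ K ≤ (m : ℝ) ^ 2 * p ^ 3) →
      ∀ B : Set (SimpleGraph (Fin n)),
        (∀ G G' : SimpleGraph (Fin n), G ≤ G' → G ∈ B → G' ∈ B) →
        probGnmp n m p B ≤ probGnp n (1 - Real.exp (-((1 + ε) * (m * p ^ 2)))) B + δ := by
  obtain ⟨θ, hθ⟩ : ∃ θ, θ = ε / 4 := ⟨_, rfl⟩
  have hθ0 : 0 < θ := by rw [hθ]; positivity
  have hθ1 : θ ≤ 1 / 4 := by rw [hθ]; linarith
  have hεθ : 1 + ε = 1 + 4 * θ := by rw [hθ]; ring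
  obtain ⟨γ, hγ⟩ : ∃ γ, γ = θ / (1 + θ * C) := ⟨_, rfl⟩
  have hγ0 : 0 < γ := by rw [hγ]; positivity
  obtain ⟨A, hA⟩ : ∃ A, A = Real.exp 1 * (2 / γ) ^ 2 / (θ / 16 * γ ^ 2) := ⟨_, rfl⟩
  have hA0 : 0 < A := by rw [hA]; positivity
  obtain ⟨h, hh⟩ : ∃ h, h = θ / 16 * γ ^ 4 := ⟨_, rfl⟩
  have hh0 : 0 < h := by rw [hh]; positivity
  obtain ⟨d, hd⟩ : ∃ d, d = δ / 4 := ⟨_, rfl⟩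
  have hd0 : 0 < d := by rw [hd]; positivity
  have hmin : 0 < min d 1 := lt_min hd0 one_pos
  refine ⟨12 / h, d, by positivity, hd0, ?_⟩
  have hbase : (1 + θ) / Real.exp θ < 1 := by
    rw [div_lt_one (Real.exp_pos _), add_comm]
    exact Real.add_one_lt_exp hθ0.ne'
  have hbase0 : 0 ≤ (1 + θ) / Real.exp θ := by positivity
  filter_upwards [eventually_ge_atTop 2,
    (tendsto_pow_atTop_nhds_zero_of_lt_one hbase0 hbase).eventually_le_const hd0,
    eventually_div_le (4 * C) one_pos,
    eventually_div_le (2 * A ^ 12 * (2 * C) ^ 6) hmin,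
    eventually_div_le (2 * A ^ 12 * (2 ^ 9 / d ^ 3)) hmin,
    eventually_div_le (2 * A ^ 15 * (2 ^ 21 / d ^ 9)) hmin,
    eventually_div_le ((12 / h) ^ 4) (show 0 < d ^ 5 / 2 ^ 7 by positivity),
    eventually_div_le ((15 / h) ^ 5) (show 0 < d ^ 7 / 2 ^ 13 by positivity),
    eventually_div_le (2 ^ 5 * C ^ 7) (show 0 < d ^ 2 by positivity)]
    with n hn2 htail hsm hE1 hE2 hE3 hF2 hF3 hG m hm p hp0 hp1 hmC hcase B hB
  rw [hεθ]
  rcases hp0.eq_or_lt with rfl | hp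
  · rw [probGnmp_zero]
    simp [hδ.le]
  have hnR : (2 : ℝ) ≤ n := by exact_mod_cast hn2
  have hn1 : (1 : ℝ) ≤ n := by linarith
  have hn0 : (0 : ℝ) < n := by linarith
  have hnm : (n : ℝ) ≤ m := by
    refine le_trans ?_ hm
    nlinarith [sq_nonneg ((n : ℝ) - 2), mul_nonneg hn0.le (sub_nonneg.2 hnR)]
  have hmR : (0 : ℝ) < m := by linarith
  have hm0 : 0 < m := by exact_mod_cast hmR
  have ht : ((1 + θ) / Real.exp θ) ^ m ≤ d :=
    (pow_le_pow_of_le_one hbase0 hbase.le (by exact_mod_cast hnm)).trans htail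
  have hsmall : 2 * p ^ 2 * n ^ 2 ≤ 1 := by
    rw [div_le_one hn0] at hsm
    have h1 : (n : ℝ) ^ 3 / 2 * p ^ 2 ≤ C :=
      (mul_le_mul_of_nonneg_right hm (sq_nonneg p)).trans hmC
    have h2 : n * (2 * p ^ 2 * n ^ 2) ≤ n * 1 := by nlinarith
    exact le_of_mul_le_mul_left h2 hn0
  have hy : ∀ β : ℕ, 0 ≤ n * p / (m * p ^ 2) ^ β := fun β => by positivity
  rcases le_or_gt (m * (n * p) ^ 3) d with h3 | h3
  · have := probGnmp_le_of_no_triangle hB hp hp1 hm0 hθ0 (by linarith) hsmall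
    linarith
  have hcase : 12 / h ≤ (m : ℝ) ^ 2 * p ^ 3 := hcase.resolve_left h3.not_ge
  rcases le_or_gt (m * (n * p) ^ 4) d with h4 | h4
  · obtain ⟨hb, hb1⟩ := error_le_of_sq_mul_pow_le hn1 hA0.le (hy 0) (by norm_num)
      (sq_mul_pow_le_of_sparse hn0 hm hp hmC hn1) hE1
    have := probGnmp_le_of_hidden hB hp hp1 hm0 hθ0 hθ1 hsmall hmC hγ hA (K := 12)
      (Or.inl ⟨rfl, rfl⟩) hb1 (by
        have : ((m : ℝ) * p ^ 2) ^ (2 + 0) / p = m ^ 2 * p ^ 3 := by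
          field_simp
          ring
        rw [this, ← hh]
        rw [div_le_iff₀ hh0] at hcase
        push_cast
        linarith)
    linarith
  rcases le_or_gt (m * (n * p) ^ 5) d with h5 | h5
  · obtain ⟨hb, hb1⟩ := error_le_of_sq_mul_pow_le hn1 hA0.le (hy 1) (by norm_num)
      (sq_mul_pow_le_of_four hn0 hm hp hd0 h4.le) hE2
    have hX := pow_div_ge_of_four hn0 hm hp hd0 h4.le
    rw [div_le_iff₀ hn0] at hF2
    have hX' : 12 / h ≤ (m * p ^ 2) ^ 3 / p :=
      le_of_pow_le_pow_left₀ (by norm_num : 4 ≠ 0) (by positivity) (by linarith)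
    have := probGnmp_le_of_hidden hB hp hp1 hm0 hθ0 hθ1 hsmall hmC hγ hA (K := 12)
      (Or.inr (Or.inl ⟨rfl, rfl⟩)) hb1 (by
        rw [← hh]
        rw [div_le_iff₀ hh0] at hX'
        push_cast
        linarith)
    linarith
  · obtain ⟨hb, hb1⟩ := error_le_of_sq_mul_pow_le hn1 hA0.le (hy 2) (by norm_num)
      (sq_mul_pow_le_of_five hn0 hm hp hd0 h5.le) hE3
    have hX := pow_div_ge_of_five hn1 hm hp hd0 h5.le
    rw [div_le_iff₀ hn0] at hF3
    have hX' : 15 / h ≤ (m * p ^ 2) ^ 4 / p :=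
      le_of_pow_le_pow_left₀ (by norm_num : 5 ≠ 0) (by positivity) (by linarith)
    have h7 : m * (n * p) ^ 7 ≤ d :=
      le_of_pow_le_pow_left₀ two_ne_zero hd0.le ((sq_mul_seven_le hn0 hm hp hmC).trans hG)
    have := probGnmp_le_of_hidden hB hp hp1 hm0 hθ0 hθ1 hsmall hmC hγ hA (K := 15)
      (Or.inr (Or.inr ⟨rfl, rfl⟩)) hb1 (by
        rw [← hh]
        rw [div_le_iff₀ hh0] at hX'
        push_cast
        linarith)
    linarith

/-- The lower comparison: already the objects assigned to exactly two vertices produce a binomial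
random graph. -/
theorem eventually_probGnp_le {ε δ : ℝ} (hε0 : 0 < ε) (hε1 : ε < 1) (hδ : 0 < δ) :
    ∀ᶠ m : ℕ in atTop, ∀ n : ℕ, ∀ p : ℝ, 0 ≤ p → p ≤ 1 → ∀ B : Set (SimpleGraph (Fin n)),
      (∀ G G' : SimpleGraph (Fin n), G ≤ G' → G ∈ B → G' ∈ B) →
      probGnp n (1 - Real.exp (-((1 - ε) * (m * p ^ 2 * (1 - p) ^ (n - 2))))) B
        ≤ probGnmp n m p B + δ := by
  have hbase : (1 - ε) * Real.exp ε < 1 := by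
    have := Real.add_one_lt_exp (neg_ne_zero.2 hε0.ne')
    rw [Real.exp_neg, lt_inv_comm₀ (by linarith) (Real.exp_pos _),
      ← one_div, lt_div_iff₀ (by linarith)] at this
    linarith
  have hbase0 : 0 ≤ (1 - ε) * Real.exp ε :=
    mul_nonneg (sub_nonneg.2 hε1.le) (Real.exp_pos _).le
  filter_upwards [(tendsto_pow_atTop_nhds_zero_of_lt_one hbase0 hbase).eventually_le_const hδ]
    with m hm n p hp0 hp1 B hB
  have := probGnp_le_probGnmp hB (m := m) hp0 hp1 hε0.le hε1
  rw [show (1 - ε) * (m * p ^ 2 * (1 - p) ^ (n - 2))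
    = (1 - ε) * m * (p ^ 2 * (1 - p) ^ (n - 2)) by ring]
  linarith

end Upper

/-! ### Passage to the limit -/

section Limits

/-- A property that holds eventually for every fixed `ε` holds eventually along some sequence
`ε n → 0`. -/
theorem exists_seq_tendsto_zero {Q : ℝ → ℕ → Prop}
    (h : ∀ ε : ℝ, 0 < ε → ε ≤ 1 / 2 → ∀ᶠ n in atTop, Q ε n) :
    ∃ ε : ℕ → ℝ, Tendsto ε atTop (𝓝 0) ∧ (∀ n, 0 < ε n ∧ ε n ≤ 1 / 2) ∧
      ∀ᶠ n in atTop, Q (ε n) n := by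
  set e : ℕ → ℝ := fun k => 1 / ((k : ℝ) + 2) with he
  have he0 : ∀ k, 0 < e k := fun k => by simp only [he]; positivity
  have he1 : ∀ k, e k ≤ 1 / 2 := fun k =>
    one_div_le_one_div_of_le two_pos (by have : (0 : ℝ) ≤ k := k.cast_nonneg; linarith)
  have het : Tendsto e atTop (𝓝 0) := by
    have := (tendsto_one_div_add_atTop_nhds_zero_nat (𝕜 := ℝ)).comp (tendsto_add_atTop_nat 1)
    refine this.congr fun k => ?_
    simp only [Function.comp_apply, he]
    push_cast
    ring_nf
  choose N hN using fun k => eventually_atTop.1 (h (e k) (he0 k) (he1 k))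
  set φ : ℕ → ℕ := fun n => Nat.findGreatest (fun k => N k ≤ n) n with hφ
  refine ⟨fun n => e (φ n), het.comp ?_, fun n => ⟨he0 _, he1 _⟩, ?_⟩
  · refine tendsto_atTop.2 fun k => ?_
    filter_upwards [eventually_ge_atTop k, eventually_ge_atTop (N k)] with n h1 h2
    exact Nat.le_findGreatest h1 h2
  · filter_upwards [eventually_ge_atTop (N 0)] with n hn
    have : N (φ n) ≤ n := Nat.findGreatest_spec (P := fun k => N k ≤ n) (Nat.zero_le n) hn
    exact hN _ n this

/-- A sandwich with error `ε` for every fixed `ε`, where the outer sequences converge along every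
vanishing sequence of parameters. -/
theorem tendsto_of_approx {x : ℕ → ℝ} {L U : ℝ → ℕ → ℝ} {a : ℝ}
    (h : ∀ ε : ℝ, 0 < ε → ε ≤ 1 / 2 → ∀ᶠ n in atTop, L ε n - ε ≤ x n ∧ x n ≤ U ε n + ε)
    (hL : ∀ ε : ℕ → ℝ, Tendsto ε atTop (𝓝 0) → (∀ n, 0 < ε n ∧ ε n ≤ 1 / 2) →
      Tendsto (fun n => L (ε n) n) atTop (𝓝 a))
    (hU : ∀ ε : ℕ → ℝ, Tendsto ε atTop (𝓝 0) → (∀ n, 0 < ε n ∧ ε n ≤ 1 / 2) →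
      Tendsto (fun n => U (ε n) n) atTop (𝓝 a)) : Tendsto x atTop (𝓝 a) := by
  obtain ⟨ε, hε, hε1, hQ⟩ := exists_seq_tendsto_zero h
  have h1 := (hL ε hε hε1).sub hε
  have h2 := (hU ε hε hε1).add hε
  rw [sub_zero] at h1
  rw [add_zero] at h2
  exact tendsto_of_tendsto_of_tendsto_of_le_of_le' h1 h2 (hQ.mono fun _ h => h.1)
    (hQ.mono fun _ h => h.2)

theorem one_sub_exp_mul_le {ε x : ℝ} (hε : 0 ≤ ε) :
    1 - Real.exp (-((1 + ε) * x)) ≤ (1 + ε) * (1 - Real.exp (-x)) := by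
  have h := one_add_mul_self_le_rpow_one_add (s := Real.exp (-x) - 1)
    (by linarith [Real.exp_pos (-x)]) (p := 1 + ε) (by linarith)
  rw [add_sub_cancel, ← Real.exp_mul, show -x * (1 + ε) = -((1 + ε) * x) by ring] at h
  linarith

theorem mul_one_sub_exp_le {ε x : ℝ} (hε0 : 0 ≤ ε) (hε1 : ε ≤ 1) :
    (1 - ε) * (1 - Real.exp (-x)) ≤ 1 - Real.exp (-((1 - ε) * x)) := by
  have h := rpow_one_add_le_one_add_mul_self (s := Real.exp (-x) - 1)
    (by linarith [Real.exp_pos (-x)]) (p := 1 - ε) (by linarith) (by linarith)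
  rw [add_sub_cancel, ← Real.exp_mul, show -x * (1 - ε) = -((1 - ε) * x) by ring] at h
  linarith

theorem one_sub_mul_le_pow {n : ℕ} {p : ℝ} (hp0 : 0 ≤ p) (hp1 : p ≤ 1) :
    1 - n * p ≤ (1 - p) ^ (n - 2) := by
  have h := one_add_mul_le_pow (a := -p) (by linarith) (n - 2)
  have h2 : ((n - 2 : ℕ) : ℝ) * p ≤ n * p :=
    mul_le_mul_of_nonneg_right (by exact_mod_cast Nat.sub_le n 2) hp0
  rw [← sub_eq_add_neg] at h
  linarith

theorem probGnmp_le_complete {n m : ℕ} {p : ℝ} {B : Set (SimpleGraph (Fin n))}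
    (hB : ∀ G G' : SimpleGraph (Fin n), G ≤ G' → G ∈ B → G' ∈ B) :
    probGnmp n m p B ≤ probGnp n 1 B := by
  by_cases h : (⊤ : SimpleGraph (Fin n)) ∈ B
  · have h1 : asProb 1 = 1 := by
      ext; simp [asProb_coe zero_le_one le_rfl]
    have h2 : probGnp n 1 B = 1 := by
      rw [probGnp, h1, SimpleGraph.binomialRandom_one, measureReal_def,
        Measure.dirac_apply' _ (measurableSet_graphs B)]
      simp [h]
    rw [h2, probGnmp]
    exact measureReal_le_one
  · have h1 : B = ∅ := Set.eq_empty_iff_forall_notMem.2 fun G hG => h (hB G ⊤ le_top hG)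
    simp [h1, probGnmp, probGnp]

variable {α : ℝ} {m : ℕ → ℕ}

theorem eventually_cube_le (hα : 3 ≤ α) (hm : ∀ n : ℕ, |(m n : ℝ) - (n : ℝ) ^ α| < 1) :
    ∀ᶠ n : ℕ in atTop, (n : ℝ) ^ 3 / 2 ≤ m n := by
  filter_upwards [eventually_ge_atTop 2] with n hn
  have hn2 : (2 : ℝ) ≤ n := by exact_mod_cast hn
  have h1 := (abs_lt.1 (hm n)).1
  have h2 : (n : ℝ) ^ (3 : ℝ) ≤ (n : ℝ) ^ α :=
    Real.rpow_le_rpow_of_exponent_le (by linarith) hα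
  rw [show (3 : ℝ) = ((3 : ℕ) : ℝ) by norm_num, Real.rpow_natCast] at h2
  have h3 := pow_le_pow_left₀ (by norm_num) hn2 3
  linarith

theorem eventually_mul_cube_le (hα : 3 < α) (hm : ∀ n : ℕ, |(m n : ℝ) - (n : ℝ) ^ α| < 1) (K : ℝ) :
    ∀ᶠ n : ℕ in atTop, K * (n : ℝ) ^ 3 ≤ m n := by
  have h1 := ((tendsto_rpow_atTop (sub_pos.2 hα)).comp
    tendsto_natCast_atTop_atTop).eventually_ge_atTop (K + 1)
  filter_upwards [h1, eventually_ge_atTop 1] with n h1 hn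
  have hn1 : (1 : ℝ) ≤ n := by exact_mod_cast hn
  have h2 := (abs_lt.1 (hm n)).1
  have h3 : (n : ℝ) ^ α = (n : ℝ) ^ (α - 3) * n ^ 3 := by
    rw [← Real.rpow_natCast (n : ℝ) 3, ← Real.rpow_add (by linarith)]
    norm_num
  have h4 : (K + 1) * (n : ℝ) ^ 3 ≤ (n : ℝ) ^ (α - 3) * n ^ 3 :=
    mul_le_mul_of_nonneg_right h1 (by positivity)
  have h5 : (1 : ℝ) ≤ (n : ℝ) ^ 3 := one_le_pow₀ hn1
  linarith

theorem tendsto_of_cube_le (h : ∀ᶠ n : ℕ in atTop, (n : ℝ) ^ 3 / 2 ≤ m n) :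
    Tendsto m atTop atTop := by
  have h1 : Tendsto (fun n => (m n : ℝ)) atTop atTop := by
    refine tendsto_atTop_mono' atTop ?_ (tendsto_natCast_atTop_atTop (R := ℝ))
    filter_upwards [h, eventually_ge_atTop 2] with n h hn
    have hn2 : (2 : ℝ) ≤ n := by exact_mod_cast hn
    refine le_trans ?_ h
    nlinarith [mul_nonneg (mul_nonneg (show (0 : ℝ) ≤ n by linarith) (show (0 : ℝ) ≤ n by linarith))
      (sub_nonneg.2 hn2)]
  exact tendsto_natCast_atTop_iff.1 h1

/-- The lower bound on `p`: triangles in the intersection graph are much rarer than in the binomial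
random graph. -/
theorem eventually_le_sq_mul_cube (hα : 3 ≤ α) (hm : ∀ n : ℕ, |(m n : ℝ) - (n : ℝ) ^ α| < 1)
    {p : ℕ → ℝ} (hp : ∀ n, 0 ≤ p n)
    (hO : (fun n : ℕ => 1 / ((n : ℝ) * (m n : ℝ) ^ (1 / 3 : ℝ))) =O[atTop] p)
    (ho : α = 3 → (fun n : ℕ => 1 / ((n : ℝ) * (m n : ℝ) ^ (1 / 3 : ℝ))) =o[atTop] p)
    {K : ℝ} (hK : 0 < K) : ∀ᶠ n in atTop, K ≤ (m n : ℝ) ^ 2 * p n ^ 3 := by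
  obtain ⟨c, hc, hcp, hcm⟩ : ∃ c : ℝ, 0 < c ∧
      (∀ᶠ n : ℕ in atTop, 1 / ((n : ℝ) * (m n : ℝ) ^ (1 / 3 : ℝ)) ≤ c * p n) ∧
      ∀ᶠ n : ℕ in atTop, K * c ^ 3 * (n : ℝ) ^ 3 ≤ m n := by
    have habs : ∀ n : ℕ, ‖1 / ((n : ℝ) * (m n : ℝ) ^ (1 / 3 : ℝ))‖
        = 1 / ((n : ℝ) * (m n : ℝ) ^ (1 / 3 : ℝ)) := fun n => by
      rw [Real.norm_of_nonneg]; positivity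
    rcases hα.eq_or_lt with h3 | h3
    · refine ⟨1 / (2 * (K + 1)), by positivity, ?_, ?_⟩
      · filter_upwards [(ho h3.symm).bound (show 0 < 1 / (2 * (K + 1)) by positivity)] with n hn
        rwa [habs, Real.norm_of_nonneg (hp n)] at hn
      · filter_upwards [eventually_cube_le hα hm] with n hn
        refine le_trans ?_ hn
        have h4 : K * (1 / (2 * (K + 1))) ^ 3 ≤ 1 / 2 := by
          have h5 : 1 / (2 * (K + 1)) ≤ 1 := by
            rw [div_le_one (by positivity)]; linarith
          have h6 : (1 / (2 * (K + 1))) ^ 3 ≤ 1 / (2 * (K + 1)) :=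
            pow_le_of_le_one (by positivity) h5 (by norm_num)
          refine (mul_le_mul_of_nonneg_left h6 hK.le).trans ?_
          rw [mul_one_div, div_le_div_iff₀ (by positivity) two_pos]
          linarith
        have h7 : (0 : ℝ) ≤ (n : ℝ) ^ 3 := by positivity
        nlinarith
    · obtain ⟨c, hc, hb⟩ := hO.exists_pos
      refine ⟨c, hc, ?_, eventually_mul_cube_le h3 hm _⟩
      filter_upwards [hb.bound] with n hn
      rwa [habs, Real.norm_of_nonneg (hp n)] at hn
  filter_upwards [hcp, hcm, eventually_ge_atTop 1, eventually_cube_le hα hm] with n h1 h2 hn hmn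
  have hn0 : (0 : ℝ) < n := by exact_mod_cast hn
  have hm0 : (0 : ℝ) < m n := lt_of_lt_of_le (by positivity) hmn
  have h3 := pow_le_pow_left₀ (by positivity) h1 3
  have h4 : ((m n : ℝ) ^ (1 / 3 : ℝ)) ^ 3 = m n := by
    rw [← Real.rpow_natCast, ← Real.rpow_mul hm0.le]
    norm_num
  rw [div_pow, mul_pow, h4, one_pow, div_le_iff₀ (by positivity)] at h3
  have h5 : K * c ^ 3 * (n : ℝ) ^ 3 * 1
      ≤ c ^ 3 * (n : ℝ) ^ 3 * ((m n : ℝ) ^ 2 * p n ^ 3) := by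
    calc _ ≤ (m n : ℝ) * ((c * p n) ^ 3 * (n ^ 3 * m n)) :=
          mul_le_mul (by linarith) h3 zero_le_one hm0.le
      _ = _ := by ring
  have h6 : c ^ 3 * (n : ℝ) ^ 3 * K ≤ c ^ 3 * (n : ℝ) ^ 3 * ((m n : ℝ) ^ 2 * p n ^ 3) := by
    linarith
  exact le_of_mul_le_mul_left h6 (by positivity)

theorem eventually_mul_le_of_isBigO (h3 : ∀ᶠ n : ℕ in atTop, (n : ℝ) ^ 3 / 2 ≤ m n) {p : ℕ → ℝ}
    (hp : ∀ n, 0 ≤ p n) (hO : p =O[atTop] (fun n : ℕ => Real.sqrt (Real.log n / m n)))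
    {d : ℝ} (hd : 0 < d) : ∀ᶠ n : ℕ in atTop, n * p n ≤ d := by
  obtain ⟨c, hc, hb⟩ := hO.exists_pos
  have hlog : Tendsto (fun n : ℕ => 2 * c ^ 2 * (Real.log n / n)) atTop (𝓝 0) := by
    have h1 := (Real.isLittleO_log_id_atTop.tendsto_div_nhds_zero).comp
      (tendsto_natCast_atTop_atTop (R := ℝ))
    simpa using h1.const_mul (2 * c ^ 2)
  filter_upwards [hb.bound, h3, eventually_ge_atTop 1,
    hlog.eventually_le_const (show 0 < d ^ 2 by positivity)] with n h1 h2 hn hl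
  have hn1 : (1 : ℝ) ≤ n := by exact_mod_cast hn
  have hn0 : (0 : ℝ) < n := by linarith
  have hm0 : (0 : ℝ) < m n := lt_of_lt_of_le (by positivity) h2
  have hlog0 := Real.log_nonneg hn1
  rw [Real.norm_of_nonneg (hp n), Real.norm_of_nonneg (Real.sqrt_nonneg _)] at h1
  have h4 := pow_le_pow_left₀ (hp n) h1 2
  rw [mul_pow, Real.sq_sqrt (by positivity)] at h4
  refine le_of_pow_le_pow_left₀ two_ne_zero hd.le (le_trans ?_ hl)
  calc (n * p n) ^ 2 = n ^ 2 * p n ^ 2 := by ring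
    _ ≤ n ^ 2 * (c ^ 2 * (Real.log n / m n)) := by gcongr
    _ ≤ n ^ 2 * (c ^ 2 * (Real.log n / (n ^ 3 / 2))) := by gcongr
    _ = _ := by field_simp

end Limits

/-! ### From the binomial graph to the intersection graph -/

section Increasing

variable {α a : ℝ} {m : ℕ → ℕ} {A : ∀ n : ℕ, Set (SimpleGraph (Fin n))}

theorem edgeProb_nonneg {n m : ℕ} {p : ℝ} (hp1 : p ≤ 1) : 0 ≤ edgeProb n m p := by
  rw [edgeProb, sub_nonneg, Real.exp_le_one_iff, neg_nonpos]
  have := sub_nonneg.2 hp1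
  positivity

theorem edgeProb_le_one {n m : ℕ} {p : ℝ} : edgeProb n m p ≤ 1 :=
  sub_le_self _ (Real.exp_pos _).le

theorem eventually_probGnmp_le_edgeProb (h3 : ∀ᶠ n : ℕ in atTop, (n : ℝ) ^ 3 / 2 ≤ m n)
    (hA : ∀ n, ∀ G G' : SimpleGraph (Fin n), G ≤ G' → G ∈ A n → G' ∈ A n) {p : ℕ → ℝ}
    (hp : ∀ n, p n ∈ Set.Icc (0 : ℝ) 1)
    (hK : ∀ K : ℝ, 0 < K → ∀ᶠ n in atTop, K ≤ (m n : ℝ) ^ 2 * p n ^ 3)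
    (hnp : ∀ d : ℝ, 0 < d → ∀ᶠ n : ℕ in atTop, n * p n ≤ d) {ε : ℝ} (hε0 : 0 < ε)
    (hε1 : ε ≤ 1 / 2) : ∀ᶠ n in atTop, probGnmp n (m n) (p n) (A n)
      ≤ probGnp n (min 1 ((1 + ε) * edgeProb n (m n) (p n))) (A n) + ε := by
  -- Where `(1 + ε) * edgeProb` exceeds one the target is the complete graph; elsewhere `m p ^ 2` is
  -- bounded by a constant.
  obtain ⟨C, hC⟩ : ∃ C, C = 2 * (-Real.log (ε / (1 + ε))) + 1 := ⟨_, rfl⟩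
  have hlog : Real.log (ε / (1 + ε)) ≤ 0 :=
    Real.log_nonpos (by positivity) (by rw [div_le_one (by positivity)]; linarith)
  have hC0 : 0 < C := by rw [hC]; linarith
  obtain ⟨K, η, hK0, -, hU⟩ := eventually_probGnmp_le (ε := ε / 2) (by positivity) (by linarith)
    hε0 hC0
  filter_upwards [hU, h3, hK K hK0, hnp (ε / 8) (by positivity)] with n hU h3 hK hnp
  rcases le_or_gt 1 ((1 + ε) * edgeProb n (m n) (p n)) with h1 | h1
  · rw [min_eq_left h1]
    have := probGnmp_le_complete (m := m n) (p := p n) (hA n)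
    linarith
  rw [min_eq_right h1.le]
  obtain ⟨hp0, hp1⟩ := hp n
  set w := (1 - p n) ^ (n - 2) with hw
  have hw1 : 1 - ε / 8 ≤ w := by
    have := one_sub_mul_le_pow (n := n) hp0 hp1
    linarith
  set x := (m n : ℝ) * p n ^ 2 * w with hx
  have hmp : 0 ≤ (m n : ℝ) * p n ^ 2 := by positivity
  have hx1 : (m n : ℝ) * p n ^ 2 * (1 - ε / 8) ≤ x := mul_le_mul_of_nonneg_left hw1 hmp
  have hxC : x ≤ -Real.log (ε / (1 + ε)) := by
    rw [le_neg, Real.log_le_iff_le_exp (by positivity), div_le_iff₀ (by positivity)]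
    have : edgeProb n (m n) (p n) = 1 - Real.exp (-x) := rfl
    rw [this] at h1
    linarith
  have hmC : (m n : ℝ) * p n ^ 2 ≤ C := by
    rw [hC]
    nlinarith
  refine (hU (m n) h3 (p n) hp0 hp1 hmC (Or.inr hK) (A n) (hA n)).trans ?_
  gcongr
  refine probGnp_mono (hA n) ?_ ?_ h1.le
  · rw [sub_nonneg, Real.exp_le_one_iff, neg_nonpos]; positivity
  · refine le_trans ?_ (one_sub_exp_mul_le (x := x) hε0.le)
    refine sub_le_sub_left (Real.exp_le_exp.2 (neg_le_neg ?_)) 1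
    have h5 : (1 + ε) * ((m n : ℝ) * p n ^ 2 * (1 - ε / 8)) ≤ (1 + ε) * x :=
      mul_le_mul_of_nonneg_left hx1 (by linarith)
    refine le_trans ?_ h5
    nlinarith [mul_nonneg hmp (show 0 ≤ ε / 2 - ε / 8 - ε ^ 2 / 8 by nlinarith)]

/-- The transfer from the binomial graph to the intersection graph, for increasing properties. -/
theorem tendsto_probGnmp_of_increasing (hα : 3 ≤ α)
    (hm : ∀ n : ℕ, |(m n : ℝ) - (n : ℝ) ^ α| < 1)
    (hA : ∀ n, ∀ G G' : SimpleGraph (Fin n), G ≤ G' → G ∈ A n → G' ∈ A n) {p : ℕ → ℝ}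
    (hp : ∀ n, p n ∈ Set.Icc (0 : ℝ) 1)
    (hO : (fun n : ℕ => 1 / ((n : ℝ) * (m n : ℝ) ^ (1 / 3 : ℝ))) =O[atTop] p)
    (hO' : p =O[atTop] (fun n : ℕ => Real.sqrt (Real.log n / m n)))
    (ho : α = 3 → (fun n : ℕ => 1 / ((n : ℝ) * (m n : ℝ) ^ (1 / 3 : ℝ))) =o[atTop] p)
    (h : ∀ ε : ℕ → ℝ, Tendsto ε atTop (𝓝 0) →
      (∀ᶠ n in atTop, (1 + ε n) * edgeProb n (m n) (p n) ∈ Set.Icc (0 : ℝ) 1) →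
      Tendsto (fun n => probGnp n ((1 + ε n) * edgeProb n (m n) (p n)) (A n)) atTop (𝓝 a)) :
    Tendsto (fun n => probGnmp n (m n) (p n) (A n)) atTop (𝓝 a) := by
  have h3 := eventually_cube_le hα hm
  have hq0 : ∀ n, 0 ≤ edgeProb n (m n) (p n) := fun n => edgeProb_nonneg (hp n).2
  refine tendsto_of_approx
    (L := fun ε n => probGnp n ((1 - ε) * edgeProb n (m n) (p n)) (A n))
    (U := fun ε n => probGnp n (min 1 ((1 + ε) * edgeProb n (m n) (p n))) (A n))
    (fun ε hε0 hε1 => ?_) (fun ε hε hε1 => ?_) (fun ε hε hε1 => ?_)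
  · filter_upwards [eventually_probGnmp_le_edgeProb h3 hA hp
      (fun K hK => eventually_le_sq_mul_cube hα hm (fun n => (hp n).1) hO ho hK)
      (fun d hd => eventually_mul_le_of_isBigO h3 (fun n => (hp n).1) hO' hd) hε0 hε1,
      (tendsto_of_cube_le h3).eventually
        (eventually_probGnp_le hε0 (show ε < 1 by linarith) hε0)] with n hU hL
    refine ⟨?_, hU⟩
    have h4 := hL n (p n) (hp n).1 (hp n).2 (A n) (hA n)
    have h5 : probGnp n ((1 - ε) * edgeProb n (m n) (p n)) (A n) ≤ _ := probGnp_mono (hA n)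
      (mul_nonneg (show (0 : ℝ) ≤ 1 - ε by linarith) (hq0 n))
      (mul_one_sub_exp_le (x := (m n : ℝ) * p n ^ 2 * (1 - p n) ^ (n - 2)) hε0.le (by linarith))
      (sub_le_self _ (Real.exp_pos _).le)
    linarith
  · have h4 := h (fun n => -ε n) (by simpa using hε.neg) (Eventually.of_forall fun n => ?_)
    · simpa only [← sub_eq_add_neg] using h4
    · have := hε1 n
      have h6 := edgeProb_le_one (n := n) (m := m n) (p := p n)
      refine ⟨mul_nonneg (by linarith) (hq0 n), ?_⟩
      exact mul_le_one₀ (by linarith) (hq0 n) h6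
  · -- The minimum with one is attained by a smaller `ε`.
    set ε' : ℕ → ℝ := fun n => if (1 + ε n) * edgeProb n (m n) (p n) ≤ 1 then ε n
      else 1 / edgeProb n (m n) (p n) - 1 with hε'
    have key : ∀ n, (1 + ε' n) * edgeProb n (m n) (p n)
        = min 1 ((1 + ε n) * edgeProb n (m n) (p n)) ∧ 0 ≤ ε' n ∧ ε' n ≤ ε n := by
      intro n
      have h6 := edgeProb_le_one (n := n) (m := m n) (p := p n)
      have he := hε1 n
      simp only [hε']
      split_ifs with h7
      · exact ⟨(min_eq_right h7).symm, he.1.le, le_rfl⟩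
      · push Not at h7
        have hpos : 0 < edgeProb n (m n) (p n) := by
          rcases (hq0 n).eq_or_lt with h0 | h0
          · rw [← h0] at h7; linarith
          · exact h0
        refine ⟨?_, ?_, ?_⟩
        · rw [min_eq_left h7.le, add_sub_cancel, one_div, inv_mul_cancel₀ hpos.ne']
        · rw [sub_nonneg, le_div_iff₀ hpos]; linarith
        · rw [sub_le_iff_le_add, div_le_iff₀ hpos]; linarith
    have hlim : Tendsto ε' atTop (𝓝 0) :=
      squeeze_zero (fun n => (key n).2.1) (fun n => (key n).2.2) hε
    refine (h ε' hlim (Eventually.of_forall fun n => ?_)).congr fun n => by rw [(key n).1]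
    rw [(key n).1]
    exact ⟨le_min zero_le_one (mul_nonneg (by linarith [(hε1 n).1]) (hq0 n)), min_le_left _ _⟩

end Increasing

/-! ### From the intersection graph to the binomial graph -/

section Converse

variable {α a : ℝ} {m : ℕ → ℕ} {A : ∀ n : ℕ, Set (SimpleGraph (Fin n))}

/-- With `p = √(lam / m)`, triangles in the intersection graph are absent or much rarer than in the
binomial random graph, as soon as `n q` avoids a compact subset of `(0, ∞)`. -/
theorem eventually_triangle_dichotomy (hα : 3 ≤ α)
    (hm : ∀ n : ℕ, |(m n : ℝ) - (n : ℝ) ^ α| < 1) {q : ℕ → ℝ} (hq : ∀ n, 0 ≤ q n)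
    (hgap : α = 3 → ∀ c C : ℝ, 0 < c → ∀ᶠ n : ℕ in atTop, (n : ℝ) * q n ∉ Set.Icc c C)
    {lam : ℕ → ℝ} {D K η : ℝ} (hD : 0 < D) (hK : 0 < K) (hη : 0 < η)
    (hl1 : ∀ n, q n / 2 ≤ lam n) (hl2 : ∀ n, lam n ≤ q n / D) :
    ∀ᶠ n : ℕ in atTop, m n * (n * √(lam n / m n)) ^ 3 ≤ η
      ∨ K ≤ (m n : ℝ) ^ 2 * √(lam n / m n) ^ 3 := by
  have hl0 : ∀ n, 0 ≤ lam n := fun n => (div_nonneg (hq n) two_pos.le).trans (hl1 n)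
  -- Both alternatives are compared after squaring, which removes the square root.
  suffices H : ∀ᶠ n : ℕ in atTop, 0 < (m n : ℝ) ∧
      ((n : ℝ) ^ 6 * lam n ^ 3 / m n ≤ η ^ 2 ∨ K ^ 2 ≤ m n * lam n ^ 3) by
    filter_upwards [H] with n ⟨hm0, h⟩
    have hs : √(lam n / m n) ^ 2 = lam n / m n := Real.sq_sqrt (div_nonneg (hl0 n) hm0.le)
    refine h.imp (fun h => ?_) fun h => ?_
    · refine le_of_pow_le_pow_left₀ two_ne_zero hη.le (le_trans (le_of_eq ?_) h)
      calc (m n * (n * √(lam n / m n)) ^ 3) ^ 2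
          = (m n : ℝ) ^ 2 * n ^ 6 * (√(lam n / m n) ^ 2) ^ 3 := by ring
        _ = _ := by rw [hs]; field_simp
    · refine le_of_pow_le_pow_left₀ two_ne_zero (by positivity) (h.trans (le_of_eq ?_))
      calc (m n : ℝ) * lam n ^ 3 = (m n : ℝ) ^ 4 * (lam n / m n) ^ 3 := by field_simp
        _ = (m n : ℝ) ^ 4 * (√(lam n / m n) ^ 2) ^ 3 := by rw [hs]
        _ = _ := by ring
  have h3 := eventually_cube_le hα hm
  rcases hα.eq_or_lt with hα3 | hα3
  · obtain ⟨u, hu⟩ : ∃ u, u = min 1 (η ^ 2) := ⟨_, rfl⟩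
    have hu0 : 0 < u := by rw [hu]; exact lt_min one_pos (by positivity)
    have hu1 : u ≤ 1 := by rw [hu]; exact min_le_left _ _
    have hu2 : u ≤ η ^ 2 := by rw [hu]; exact min_le_right _ _
    filter_upwards [hgap hα3.symm (D * u / 2) (16 * (K + 1)) (by positivity), h3,
      eventually_ge_atTop 1] with n hgap h3 hn
    have hn0 : (0 : ℝ) < n := by exact_mod_cast hn
    have hm0 : (0 : ℝ) < m n := lt_of_lt_of_le (by positivity) h3
    refine ⟨hm0, ?_⟩
    rcases lt_or_ge ((n : ℝ) * q n) (D * u / 2) with h4 | h4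
    · left
      have h5 : (n : ℝ) * lam n ≤ u / 2 := by
        calc (n : ℝ) * lam n ≤ n * (q n / D) := mul_le_mul_of_nonneg_left (hl2 n) hn0.le
          _ = n * q n / D := by ring
          _ ≤ D * u / 2 / D := by gcongr
          _ = u / 2 := by field_simp
      have h6 := pow_le_pow_left₀ (mul_nonneg hn0.le (hl0 n)) h5 3
      rw [div_le_iff₀ hm0]
      have h7 : u ^ 3 ≤ u := pow_le_of_le_one hu0.le hu1 (by norm_num)
      have h8 : ((n : ℝ) * lam n) ^ 3 ≤ η ^ 2 / 2 := by
        have : (u / 2) ^ 3 = u ^ 3 / 8 := by ring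
        linarith
      calc (n : ℝ) ^ 6 * lam n ^ 3 = n ^ 3 * (n * lam n) ^ 3 := by ring
        _ ≤ n ^ 3 * (η ^ 2 / 2) := by gcongr
        _ = η ^ 2 * (n ^ 3 / 2) := by ring
        _ ≤ _ := by gcongr
    · right
      have h5 : 16 * (K + 1) ≤ (n : ℝ) * q n := by
        by_contra! h6
        exact hgap ⟨h4, h6.le⟩
      have h6 := pow_le_pow_left₀ (by positivity) h5 3
      have h7 := pow_le_pow_left₀ (div_nonneg (hq n) two_pos.le) (hl1 n) 3
      have hq3 : 0 ≤ q n ^ 3 := pow_nonneg (hq n) 3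
      calc K ^ 2 ≤ (16 * (K + 1)) ^ 3 / 16 := by
            have : (16 * (K + 1)) ^ 3 / 16 = 256 * (K + 1) ^ 3 := by ring
            rw [this]
            nlinarith [pow_pos hK 3, pow_pos hK 2]
        _ ≤ ((n : ℝ) * q n) ^ 3 / 16 := by gcongr
        _ = n ^ 3 / 2 * (q n / 2) ^ 3 := by ring
        _ ≤ _ := mul_le_mul h3 h7 (pow_nonneg (div_nonneg (hq n) two_pos.le) 3) hm0.le
  · filter_upwards [eventually_mul_cube_le hα3 hm (K / η), h3, eventually_ge_atTop 1]
      with n h4 h3 hn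
    have hn0 : (0 : ℝ) < n := by exact_mod_cast hn
    have hm0 : (0 : ℝ) < m n := lt_of_lt_of_le (by positivity) h3
    refine ⟨hm0, ?_⟩
    rcases le_or_gt (K ^ 2) (m n * lam n ^ 3) with h5 | h5
    · exact Or.inr h5
    · left
      rw [div_mul_eq_mul_div, div_le_iff₀ hη] at h4
      have h6 := pow_le_pow_left₀ (by positivity) h4 2
      have h7 : (n : ℝ) ^ 6 * (m n * lam n ^ 3) ≤ (m n * η) ^ 2 := by
        refine le_trans ?_ h6
        calc (n : ℝ) ^ 6 * (m n * lam n ^ 3) ≤ n ^ 6 * K ^ 2 := by gcongr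
          _ = _ := by ring
      rw [div_le_iff₀ hm0]
      have h8 : (m n : ℝ) * ((n : ℝ) ^ 6 * lam n ^ 3) ≤ m n * (η ^ 2 * m n) := by linarith
      exact le_of_mul_le_mul_left h8 hm0

/-- The transfer from the intersection graph to the binomial graph, for increasing properties. -/
theorem tendsto_probGnp_of_increasing (hα : 3 ≤ α)
    (hm : ∀ n : ℕ, |(m n : ℝ) - (n : ℝ) ^ α| < 1)
    (hA : ∀ n, ∀ G G' : SimpleGraph (Fin n), G ≤ G' → G ∈ A n → G' ∈ A n) {q : ℕ → ℝ}
    (hq : ∀ n, 0 ≤ q n) (hδ : ∃ δ > 0, ∀ n, q n ≤ 1 - δ)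
    (hgap : α = 3 → ∀ c C : ℝ, 0 < c → ∀ᶠ n : ℕ in atTop, (n : ℝ) * q n ∉ Set.Icc c C)
    (h1 : ∀ ε : ℕ → ℝ, Tendsto ε atTop (𝓝 0) → Tendsto (fun n => probGnmp n (m n)
      (Real.sqrt (-(Real.log (1 - q n / (1 + ε n)) / m n))) (A n)) atTop (𝓝 a))
    (h2 : ∀ ε : ℕ → ℝ, Tendsto ε atTop (𝓝 0) → Tendsto (fun n => probGnmp n (m n)
      (Real.sqrt (-(Real.log (1 - q n) / ((1 - ε n) * m n)))) (A n)) atTop (𝓝 a)) :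
    Tendsto (fun n => probGnp n (q n) (A n)) atTop (𝓝 a) := by
  obtain ⟨δ, hδ0, hδ⟩ := hδ
  have h3 := eventually_cube_le hα hm
  have hlogδ : Real.log δ ≤ 0 :=
    Real.log_nonpos hδ0.le (by linarith [hq 0, hδ 0])
  obtain ⟨C, hC⟩ : ∃ C, C = 2 * (-Real.log δ) + 1 := ⟨_, rfl⟩
  have hC0 : 0 < C := by rw [hC]; linarith
  refine tendsto_of_approx
    (L := fun ε n => probGnmp n (m n) (√(-(Real.log (1 - q n / (1 + ε)) / m n))) (A n))
    (U := fun ε n => probGnmp n (m n) (√(-(Real.log (1 - q n) / ((1 - ε) * m n)))) (A n))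
    (fun ε hε0 hε1 => ?_) (fun ε hε _ => h1 ε hε) (fun ε hε _ => h2 ε hε)
  refine Filter.Eventually.and ?_ ?_
  · set lam : ℕ → ℝ := fun n => -Real.log (1 - q n / (1 + ε)) with hlam
    have hy : ∀ n, q n / (1 + ε) ≤ q n := fun n => div_le_self (hq n) (by linarith)
    have hy0 : ∀ n, δ ≤ 1 - q n / (1 + ε) := fun n => by linarith [hy n, hδ n]
    have hl1 : ∀ n, q n / 2 ≤ lam n := fun n => by
      have := Real.log_le_sub_one_of_pos (hδ0.trans_le (hy0 n))
      have h4 : q n / 2 ≤ q n / (1 + ε) :=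
        div_le_div_of_nonneg_left (hq n) (by linarith) (by linarith)
      simp only [hlam]
      linarith
    have hl2 : ∀ n, lam n ≤ q n / δ := fun n => by
      have hpos := hδ0.trans_le (hy0 n)
      have h4 := Real.one_sub_inv_le_log_of_pos hpos
      have h5 : ∀ z : ℝ, 0 < 1 - z → (1 - z)⁻¹ - 1 = z / (1 - z) := fun z hz => by
        rw [eq_div_iff hz.ne', sub_mul, inv_mul_cancel₀ hz.ne']
        ring
      have h5 := h5 _ hpos
      have h6 : q n / (1 + ε) / (1 - q n / (1 + ε)) ≤ q n / δ :=
        div_le_div₀ (hq n) (hy n) hδ0 (hy0 n)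
      simp only [hlam]
      linarith
    have hlC : ∀ n, lam n ≤ C := fun n => by
      have := Real.log_le_log hδ0 (hy0 n)
      simp only [hlam]
      linarith
    have hl0 : ∀ n, 0 ≤ lam n := fun n => (div_nonneg (hq n) two_pos.le).trans (hl1 n)
    obtain ⟨K, η, hK0, hη0, hU⟩ := eventually_probGnmp_le hε0 (by linarith) hε0 hC0
    filter_upwards [hU, h3,
      eventually_triangle_dichotomy hα hm hq hgap hδ0 hK0 hη0 hl1 hl2,
      (tendsto_natCast_atTop_atTop (R := ℝ)).comp (tendsto_of_cube_le h3) |>.eventually_ge_atTop C,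
      (tendsto_of_cube_le h3).eventually_ge_atTop 1] with n hU h3 hcase hmC hm1
    have hm0 : (0 : ℝ) < m n := by exact_mod_cast hm1
    have e1 : -(Real.log (1 - q n / (1 + ε)) / m n) = lam n / m n := by
      simp only [hlam]; ring
    rw [e1]
    have hsq : (m n : ℝ) * √(lam n / m n) ^ 2 = lam n := by
      rw [Real.sq_sqrt (div_nonneg (hl0 n) hm0.le)]; field_simp
    have hp1 : √(lam n / m n) ≤ 1 :=
      (Real.sqrt_le_sqrt ((div_le_one hm0).2 ((hlC n).trans hmC))).trans_eq Real.sqrt_one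
    have h4 := hU (m n) h3 _ (Real.sqrt_nonneg _) hp1 (by rw [hsq]; exact hlC n) hcase (A n) (hA n)
    rw [hsq] at h4
    have h5 : 1 - Real.exp (-((1 + ε) * lam n)) ≤ q n := by
      refine (one_sub_exp_mul_le hε0.le).trans (le_of_eq ?_)
      simp only [hlam, neg_neg]
      rw [Real.exp_log (hδ0.trans_le (hy0 n)), sub_sub_cancel]
      field_simp
    have h6 := probGnp_mono (hA n) (by
      rw [sub_nonneg, Real.exp_le_one_iff, neg_nonpos]
      exact mul_nonneg (by linarith) (hl0 n)) h5 (by linarith [hδ n])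
    linarith
  · set lam : ℕ → ℝ := fun n => -Real.log (1 - q n) / (1 - ε) with hlam
    have hε : 0 < 1 - ε := by linarith
    have hy0 : ∀ n, δ ≤ 1 - q n := fun n => by linarith [hδ n]
    have hln : ∀ n, 0 ≤ -Real.log (1 - q n) := fun n =>
      neg_nonneg.2 (Real.log_nonpos (hδ0.le.trans (hy0 n)) (by linarith [hq n]))
    have hl0 : ∀ n, 0 ≤ lam n := fun n => div_nonneg (hln n) hε.le
    have hlC : ∀ n, lam n ≤ C := fun n => by
      have := Real.log_le_log hδ0 (hy0 n)
      simp only [hlam]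
      rw [div_le_iff₀ hε, hC]
      nlinarith [hln n]
    filter_upwards [h3, eventually_ge_atTop 1,
      (tendsto_of_cube_le h3).eventually
        (eventually_probGnp_le (ε := ε / 2) (by positivity) (by linarith) hε0),
      (tendsto_natCast_atTop_atTop (R := ℝ)).comp (tendsto_of_cube_le h3) |>.eventually_ge_atTop C,
      eventually_div_le (2 * C) (show 0 < (ε / 2) ^ 2 by positivity)] with n h3 hn hL hmC hnC
    have hn0 : (0 : ℝ) < n := by exact_mod_cast hn
    have hm0 : (0 : ℝ) < m n := lt_of_lt_of_le (by positivity) h3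
    have e1 : -(Real.log (1 - q n) / ((1 - ε) * m n)) = lam n / m n := by
      simp only [hlam]; field_simp
    rw [e1]
    set p := √(lam n / m n) with hp
    have hp0 : 0 ≤ p := Real.sqrt_nonneg _
    have hpsq : p ^ 2 = lam n / m n := Real.sq_sqrt (div_nonneg (hl0 n) hm0.le)
    have hsq : (m n : ℝ) * p ^ 2 = lam n := by rw [hpsq]; field_simp
    have hp1 : p ≤ 1 :=
      (Real.sqrt_le_sqrt ((div_le_one hm0).2 ((hlC n).trans hmC))).trans_eq Real.sqrt_one
    have hnp : n * p ≤ ε / 2 := by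
      refine le_of_pow_le_pow_left₀ two_ne_zero (by positivity) (le_trans ?_ hnC)
      calc (n * p) ^ 2 = n ^ 2 * (lam n / m n) := by rw [mul_pow, hpsq]
        _ ≤ n ^ 2 * (C / (n ^ 3 / 2)) := by
            gcongr
            exact hlC n
        _ = _ := by field_simp
    have h4 := hL n p hp0 hp1 (A n) (hA n)
    rw [hsq] at h4
    have hw : 1 - ε / 2 ≤ (1 - p) ^ (n - 2) := by
      have := one_sub_mul_le_pow (n := n) hp0 hp1
      linarith
    have h5 : q n ≤ 1 - Real.exp (-((1 - ε / 2) * (lam n * (1 - p) ^ (n - 2)))) := by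
      rw [le_sub_comm, ← Real.le_log_iff_exp_le (hδ0.trans_le (hy0 n)), neg_le]
      have e2 : -Real.log (1 - q n) = (1 - ε) * lam n := by
        simp only [hlam]; field_simp
      rw [e2]
      calc (1 - ε) * lam n ≤ (1 - ε / 2) * (lam n * (1 - ε / 2)) := by
            nlinarith [mul_nonneg (sq_nonneg ε) (hl0 n)]
        _ ≤ _ := by
            refine mul_le_mul_of_nonneg_left ?_ (by linarith)
            exact mul_le_mul_of_nonneg_left hw (hl0 n)
    have h6 := probGnp_mono (hA n) (hq n) h5 (sub_le_self _ (Real.exp_pos _).le)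
    linarith

end Converse

/-! ### Monotone properties -/

theorem probGnp_compl {n : ℕ} (q : ℝ) (B : Set (SimpleGraph (Fin n))) :
    probGnp n q Bᶜ = 1 - probGnp n q B :=
  probReal_compl_eq_one_sub (measurableSet_graphs B)

theorem probGnmp_compl {n m : ℕ} (p : ℝ) (B : Set (SimpleGraph (Fin n))) :
    probGnmp n m p Bᶜ = 1 - probGnmp n m p B :=
  probReal_compl_eq_one_sub (measurableSet_graphs B)

end

theorem theorem2 (α a : ℝ) (hα : 3 ≤ α) (ha : a ∈ Set.Icc (0 : ℝ) 1)
    (m : ℕ → ℕ) (hm : ∀ n : ℕ, |(m n : ℝ) - (n : ℝ) ^ α| < 1)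
    (A : ∀ n : ℕ, Set (SimpleGraph (Fin n))) (hA : IsMonotoneProperty A) :
    (∀ p : ℕ → ℝ, (∀ n, p n ∈ Set.Icc (0 : ℝ) 1) →
      (fun n : ℕ => 1 / ((n : ℝ) * (m n : ℝ) ^ (1 / 3 : ℝ))) =O[atTop] p →
      p =O[atTop] (fun n : ℕ => Real.sqrt (Real.log n / m n)) →
      (α = 3 → (fun n : ℕ => 1 / ((n : ℝ) * (m n : ℝ) ^ (1 / 3 : ℝ))) =o[atTop] p) →
      Tendsto (fun n => probGnp n (edgeProb n (m n) (p n)) (A n)) atTop (𝓝 a) →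
      (∀ ε : ℕ → ℝ, Tendsto ε atTop (𝓝 0) →
        (∀ᶠ n in atTop, (1 + ε n) * edgeProb n (m n) (p n) ∈ Set.Icc (0 : ℝ) 1) →
        Tendsto (fun n => probGnp n ((1 + ε n) * edgeProb n (m n) (p n)) (A n)) atTop (𝓝 a)) →
      Tendsto (fun n => probGnmp n (m n) (p n) (A n)) atTop (𝓝 a)) ∧
    (∀ q : ℕ → ℝ, (∀ n, 0 ≤ q n) → (∃ δ > 0, ∀ n, q n ≤ 1 - δ) →
      (α = 3 → ∀ c C : ℝ, 0 < c → ∀ᶠ n : ℕ in atTop, (n : ℝ) * q n ∉ Set.Icc c C) →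
      (∀ ε : ℕ → ℝ, Tendsto ε atTop (𝓝 0) →
        Tendsto (fun n => probGnmp n (m n)
          (Real.sqrt (-(Real.log (1 - q n / (1 + ε n)) / m n))) (A n)) atTop (𝓝 a)) →
      (∀ ε : ℕ → ℝ, Tendsto ε atTop (𝓝 0) →
        Tendsto (fun n => probGnmp n (m n)
          (Real.sqrt (-(Real.log (1 - q n) / ((1 - ε n) * m n)))) (A n)) atTop (𝓝 a)) →
      Tendsto (fun n => probGnp n (q n) (A n)) atTop (𝓝 a)) := by
  rcases hA with hA | hA
  · refine ⟨fun p hp hO hO' ho _ h => ?_, fun q hq hδ hgap h1 h2 => ?_⟩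
    · exact tendsto_probGnmp_of_increasing hα hm (fun n => (hA n).2) hp hO hO' ho h
    · exact tendsto_probGnp_of_increasing hα hm (fun n => (hA n).2) hq hδ hgap h1 h2
  · have hB : ∀ n, ∀ G G' : SimpleGraph (Fin n), G ≤ G' → G ∈ (A n)ᶜ → G' ∈ (A n)ᶜ :=
      fun n G G' hG h h' => h ((hA n).2 G' G hG h')
    have flip : ∀ {x : ℕ → ℝ} {b : ℝ}, Tendsto x atTop (𝓝 b) →
        Tendsto (fun n => 1 - x n) atTop (𝓝 (1 - b)) := fun h => tendsto_const_nhds.sub h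
    refine ⟨fun p hp hO hO' ho _ h => ?_, fun q hq hδ hgap h1 h2 => ?_⟩
    · have := flip (tendsto_probGnmp_of_increasing (a := 1 - a) hα hm hB hp hO hO' ho
        fun ε hε hε1 => by simpa only [probGnp_compl] using flip (h ε hε hε1))
      simpa only [probGnmp_compl, sub_sub_cancel] using this
    · have := flip (tendsto_probGnp_of_increasing (a := 1 - a) hα hm hB hq hδ hgap
        (fun ε hε => by simpa only [probGnmp_compl] using flip (h1 ε hε))
        (fun ε hε => by simpa only [probGnmp_compl] using flip (h2 ε hε)))
      simpa only [probGnp_compl, sub_sub_cancel] using this
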